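/- Let $\mathcal G$ be a snake graph with tiles $G_1,\dots,G_n$ ($n\ge 1$; each tile is a unit square glued to the East or North edge of the previous one), and let $d\ge 0$ be an integer. A $d$-dimer cover of $\mathcal G$ is a multiset of edges such that every vertex is incident to exactly $d$ of its members, counted with multiplicity. The abstract string $w_{\mathcal G}$ of $\mathcal G$ has one vertex for each tile and one arrow between consecutive vertices; the first arrow is direct ($\to$) if $G_2$ lies to the right of $G_1$ and inverse ($\leftarrow$) otherwise, and the $i$-th arrow is equal to the $(i-1)$-st one if $G_{i-1},G_i,G_{i+1}$ form a zig-zag and opposite to it if they form a straight piece. Let $K$ be a field, $Q$ a quiver with finitely many vertices, $I$ a two-sided ideal of $KQ$ (for example an admissible one), $\Lambda=KQ/I$, and let $M_{\mathcal G}\in\operatorname{mod}\Lambda$ be a string module whose string in $Q$ has underlying abstract string $w_{\mathcal G}$, with standard basis $v_1,\dots,v_n$. Let $\widetilde M_{\mathcal G}=M_{\mathcal G}\otimes_K K[\varepsilon]/(\varepsilon^d)$ be the induced module over $\Lambda\otimes_K K[\varepsilon]/(\varepsilon^d)$. A submodule of $\widetilde M_{\mathcal G}$ is called canonical if it is spanned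 over $K$ by some of the vectors $v_i\otimes\varepsilon^k$. Then: 1. The number of $d$-dimer covers of $\mathcal G$ is finite and equal to the number of canonical submodules of $\widetilde M_{\mathcal G}$. If the string does not pass through a vertex of $Q$ twice, then every submodule of $\widetilde M_{\mathcal G}$ is canonical, so that the number of $d$-dimer covers is the number of all submodules of $\widetilde M_{\mathcal G}$. Let moreover $a_1,\dots,a_m$ be positive integers such that $\mathcal G=\mathcal G[a_1,\dots,a_m]$ is the snake graph of the continued fraction $[a_1,\dots,a_m]$. That is, for a function on the edges with values in $\{+,-\}$ which on every tile is equal on North and West, equal on South and East, and different on North and South, the signs of a West or South edge of $G_1$, of the $n-1$ interior edges in order, and of a North or East edge of $G_n$ form a sequence of $a_1$ equal signs, then $a_2$ opposite signs, then $a_3$ signs equal to the first ones, and so on. Write $\left(\!\binom{a}{k}\!\right)=\binom{a+k-1}{k}$. 2. The number of canonical submodules of $\widetilde M_{\mathcal G}$ is the top left entry of the matrix product $\Lambda_d(a_1)\Lambda_d(a_2)\cdots\Lambda_d(a_m)$, where $\Lambda_d(a)$ is the $(d+1)\times(d+1)$ matrix, with rows and columns indexed by $0,\dots,d$, whose $(i,j)$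 entry is $\left(\!\binom{a}{d-i-j}\!\right)$ if $i+j\le d$ and $0$ otherwise. 3. Define the higher continued fraction $(r_i[a_1,\dots,a_m])_{0\le i\le d}$ of order $d$ recursively by $r_i[a_m]=\left(\!\binom{a_m}{i}\!\right)$ and $$r_i[a_1,\dots,a_m]=\left(\!\binom{a_1}{i}\!\right)+\sum_{j=1}^{i}\left(\!\binom{a_1}{i-j}\!\right)\frac{r_{d-j}[a_2,\dots,a_m]}{r_d[a_2,\dots,a_m]}\qquad (m\ge 2).$$ Clearing denominators step by step and without cancellation writes it with a common positive denominator, $r_i[a_1,\dots,a_m]=p_i[a_1,\dots,a_m]/q[a_1,\dots,a_m]$, where $p_i[a_m]=\left(\!\binom{a_m}{i}\!\right)$, $q[a_m]=1$ and, for $m\ge2$, $q[a_1,\dots,a_m]=p_d[a_2,\dots,a_m]$ and $$p_i[a_1,\dots,a_m]=\left(\!\binom{a_1}{i}\!\right)p_d[a_2,\dots,a_m]+\sum_{j=1}^{i}\left(\!\binom{a_1}{i-j}\!\right)p_{d-j}[a_2,\dots,a_m].$$ The number of canonical submodules of $\widetilde M_{\mathcal G}$ is the numerator $p_d[a_1,\dots,a_m]$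 of $r_d[a_1,\dots,a_m]$, and, whenever $m\ge2$ and $a_2+\dots+a_m\ge 2$, the denominator $q[a_1,\dots,a_m]$ is the number of $d$-dimer covers of $\mathcal G[a_2,\dots,a_m]$. -/

import Mathlib

open scoped TensorProduct

/-! ### Snake graphs -/

/-- The two possible positions of a tile relative to the previous one. -/
inductive SnakeStep : Type
  | right
  | up
  deriving DecidableEq

/-- The lower left corner of the tile `i` (counted from `0`) of the snake graph with
`s.length + 1` tiles in which consecutive tiles are placed as prescribed by `s`. -/
def tileCorner (s : List SnakeStep) (i : ℕ) : ℕ × ℕ :=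
  ((s.take i).count SnakeStep.right, (s.take i).count SnakeStep.up)

/-- South side of the tile `i`. -/
def southSide (s : List SnakeStep) (i : ℕ) : Sym2 (ℕ × ℕ) :=
  s(tileCorner s i, tileCorner s i + (1, 0))

/-- West side of the tile `i`. -/
def westSide (s : List SnakeStep) (i : ℕ) : Sym2 (ℕ × ℕ) :=
  s(tileCorner s i, tileCorner s i + (0, 1))

/-- North side of the tile `i`. -/
def northSide (s : List SnakeStep) (i : ℕ) : Sym2 (ℕ × ℕ) :=
  s(tileCorner s i + (0, 1), tileCorner s i + (1, 1))

/-- East side of the tile `i`. -/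
def eastSide (s : List SnakeStep) (i : ℕ) : Sym2 (ℕ × ℕ) :=
  s(tileCorner s i + (1, 0), tileCorner s i + (1, 1))

/-- The snake graph with tiles `0, …, s.length`; its vertices are the points of `support`. -/
def snakeGraph (s : List SnakeStep) : SimpleGraph (ℕ × ℕ) :=
  SimpleGraph.fromEdgeSet
    {e | ∃ i ≤ s.length,
      e = southSide s i ∨ e = westSide s i ∨ e = northSide s i ∨ e = eastSide s i}

/-- The `d`-dimer covers of a graph: multisets of edges such that every vertex is incident to
exactly `d` members, counted with multiplicity. -/
def dimerCovers {W : Type*} [DecidableEq W] (G : SimpleGraph W) (d : ℕ) :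
    Set (Multiset (Sym2 W)) :=
  {D | (∀ e ∈ D, e ∈ G.edgeSet) ∧ ∀ v ∈ G.support, D.countP (fun e => v ∈ e) = d}

/-! ### The snake graph of a continued fraction -/

/-- A sign function on (the edges of) a snake graph: on every tile the North and West sides have
the same sign, the South and East sides have the same sign, and North and South differ. -/
def IsSignFunction (s : List SnakeStep) (f : Sym2 (ℕ × ℕ) → Bool) : Prop :=
  ∀ i ≤ s.length, f (northSide s i) = f (westSide s i) ∧ f (southSide s i) = f (eastSide s i) ∧
    f (northSide s i) ≠ f (southSide s i)

/-- The edge shared by the tiles `i` and `i + 1`. -/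
def interiorEdge (s : List SnakeStep) (i : Fin s.length) : Sym2 (ℕ × ℕ) :=
  match s.get i with
  | SnakeStep.right => eastSide s i
  | SnakeStep.up => northSide s i

/-- `a₁` signs `b`, followed by `a₂` signs `!b`, followed by `a₃` signs `b`, and so on. -/
def signSequence : List ℕ → Bool → List Bool
  | [], _ => []
  | k :: a, b => List.replicate k b ++ signSequence a (!b)

/-- The snake graph is the snake graph `𝒢[a₁, …, aₙ]` of the continued fraction
`[a₁, …, aₙ]` with positive integers `aᵢ`: the signs of a side `e` (West or South) of the first
tile, of the interior edges in order, and of a side `e'` (North or East) of the last tile form the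
sign sequence of `a₁, …, aₙ`. -/
def IsSnakeGraphOfCF (s : List SnakeStep) (a : List ℕ) : Prop :=
  (∀ k ∈ a, 0 < k) ∧
    ∃ f, IsSignFunction s f ∧
      ∃ e e', (e = westSide s 0 ∨ e = southSide s 0) ∧
        (e' = northSide s s.length ∨ e' = eastSide s s.length) ∧
        ∃ b, signSequence a b =
          f e :: (List.ofFn (fun i => f (interiorEdge s i)) ++ [f e'])

/-! ### Matrices and higher continued fractions -/

/-- The `(d + 1) × (d + 1)` matrix whose `(i, j)` entry (`0 ≤ i, j ≤ d`) is the number of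
multisets of size `d - i - j` in a set of `a` elements, and `0` if `i + j > d`. -/
def multichooseMatrix (d a : ℕ) : Matrix (Fin (d + 1)) (Fin (d + 1)) ℕ :=
  Matrix.of fun i j =>
    if (i : ℕ) + (j : ℕ) ≤ d then Nat.multichoose a (d - (i : ℕ) - (j : ℕ)) else 0

/-- The `i`-th entry, `0 ≤ i ≤ d`, of the higher continued fraction `[a₁, …, aₙ]` of order `d`
(the usual continued fraction is the entry `1` for `d = 1`). -/
def higherCF (d : ℕ) : List ℕ → ℕ → ℚ
  | [], _ => 1
  | [a], i => Nat.multichoose a i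
  | a :: b :: l, i => Nat.multichoose a i +
      ∑ j ∈ Finset.Icc 1 i,
        (Nat.multichoose a (i - j) : ℚ) * (higherCF d (b :: l) (d - j) / higherCF d (b :: l) d)

/-- The numerator of the entry `i` of the higher continued fraction, obtained by clearing
denominators step by step without any cancellation. -/
def higherCFNum (d : ℕ) : List ℕ → ℕ → ℕ
  | [], _ => 1
  | [a], i => Nat.multichoose a i
  | a :: b :: l, i => Nat.multichoose a i * higherCFNum d (b :: l) d +
      ∑ j ∈ Finset.Icc 1 i, Nat.multichoose a (i - j) * higherCFNum d (b :: l) (d - j)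

/-- The common denominator of the entries of the higher continued fraction, obtained by clearing
denominators step by step without any cancellation. -/
def higherCFDen (d : ℕ) : List ℕ → ℕ
  | [] => 1
  | [_] => 1
  | _ :: b :: l => higherCFNum d (b :: l) d

/-! ### The abstract string of a snake graph -/

/-- The arrows of the abstract string following an arrow `b` that belongs to the step `p`
(`true` is a direct arrow, `false` an inverse one): the arrow is repeated at a zig-zag and
reversed at a straight piece. -/
def abstractStringAux : SnakeStep → Bool → List SnakeStep → List Bool
  | _, _, [] => []
  | p, b, q :: l =>
    let c := if q = p then !b else b
    c :: abstractStringAux q c l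

/-- The arrows of the abstract string of a snake graph; it has one vertex per tile. -/
def abstractString : List SnakeStep → List Bool
  | [] => []
  | p :: l => decide (p = SnakeStep.right) :: abstractStringAux p (decide (p = SnakeStep.right)) l

/-! ### Path algebras -/

section PathAlgebra

variable (K : Type*) [Field K] (V : Type*) [Fintype V] [Quiver V]

/-- Defining relations of the path algebra on the generators `e_v` (`v` a vertex) and `α` (an
arrow). Products are ordered so that left modules are representations of the quiver: an arrow
`α : x ⟶ y` satisfies `e_y α e_x = α`. -/
inductive PathRel : FreeAlgebra K (V ⊕ Quiver.Total V) → FreeAlgebra K (V ⊕ Quiver.Total V) → Prop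
  | idem (v : V) : PathRel
      (FreeAlgebra.ι K (Sum.inl v) * FreeAlgebra.ι K (Sum.inl v)) (FreeAlgebra.ι K (Sum.inl v))
  | orth (v v' : V) (h : v ≠ v') : PathRel
      (FreeAlgebra.ι K (Sum.inl v) * FreeAlgebra.ι K (Sum.inl v')) 0
  | one : PathRel (∑ v : V, FreeAlgebra.ι K (Sum.inl v)) 1
  | target (a : Quiver.Total V) : PathRel
      (FreeAlgebra.ι K (Sum.inl a.right) * FreeAlgebra.ι K (Sum.inr a))
      (FreeAlgebra.ι K (Sum.inr a))
  | source (a : Quiver.Total V) : PathRel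
      (FreeAlgebra.ι K (Sum.inr a) * FreeAlgebra.ι K (Sum.inl a.left))
      (FreeAlgebra.ι K (Sum.inr a))

/-- The path algebra `KQ` of a quiver `Q` with finitely many vertices. -/
abbrev PathAlgebra : Type _ := RingQuot (PathRel K V)

end PathAlgebra

/-! ### Strings and string modules -/

/-- The position of the source of the `i`-th arrow of an abstract string. -/
def tailIndex (u : List Bool) (i : Fin u.length) : Fin (u.length + 1) :=
  if u.get i then i.castSucc else i.succ

/-- The position of the target of the `i`-th arrow of an abstract string. -/
def headIndex (u : List Bool) (i : Fin u.length) : Fin (u.length + 1) :=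
  if u.get i then i.succ else i.castSucc

/-- A string in a quiver with underlying abstract string `u`: a walk whose `i`-th letter is an
arrow (if `u` has a direct arrow there) or the formal inverse of an arrow (otherwise), without
subwords `α α⁻¹` or `α⁻¹ α`. -/
structure QuiverString (V : Type*) [Quiver V] (u : List Bool) where
  /-- the vertices of the walk -/
  vertex : Fin (u.length + 1) → V
  /-- the arrows of the walk -/
  letter : Fin u.length → Quiver.Total V
  left_letter : ∀ i, (letter i).left = vertex (tailIndex u i)
  right_letter : ∀ i, (letter i).right = vertex (headIndex u i)
  reduced : ∀ i j : Fin u.length, (j : ℕ) = (i : ℕ) + 1 → u.get i ≠ u.get j → letter i ≠ letter j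

namespace QuiverString

variable (K : Type*) [Field K] {V : Type*} [Quiver V] {u : List Bool} (w : QuiverString V u)

open Classical in
/-- The idempotent `e_v` projects onto the span of the basis vectors at vertex `v`. -/
noncomputable def vertexMap (v : V) : Module.End K (Fin (u.length + 1) → K) :=
  LinearMap.pi fun i => if w.vertex i = v then LinearMap.proj i else 0

open Classical in
/-- The arrow `a` sends the basis vector at the source of each letter equal to `a` to the basis
vector at the target of that letter, and kills the other basis vectors. -/
noncomputable def arrowMap (a : Quiver.Total V) : Module.End K (Fin (u.length + 1) → K) :=
  ∑ i : Fin u.length, if w.letter i = a then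
    (LinearMap.single K (fun _ => K) (headIndex u i)) ∘ₗ LinearMap.proj (tailIndex u i) else 0

theorem vertexMap_apply (v : V) (x : Fin (u.length + 1) → K) (i : Fin (u.length + 1)) :
    w.vertexMap K v x i = open Classical in if w.vertex i = v then x i else 0 := by
  classical
  simp only [vertexMap, LinearMap.pi_apply]
  split_ifs <;> simp

theorem arrowMap_apply (a : Quiver.Total V) (x : Fin (u.length + 1) → K)
    (j : Fin (u.length + 1)) :
    w.arrowMap K a x j = open Classical in
      ∑ i : Fin u.length, if w.letter i = a ∧ headIndex u i = j then x (tailIndex u i) else 0 := by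
  classical
  simp only [arrowMap, LinearMap.sum_apply, Finset.sum_apply]
  refine Finset.sum_congr rfl fun i _ => ?_
  by_cases h : w.letter i = a
  · by_cases h' : headIndex u i = j
    · subst h'; simp [h]
    · simp [h, h', Ne.symm h']
  · simp [h]

variable [Fintype V]

/-- The action of the path algebra on the string representation `M(w)`. -/
noncomputable def pathAction : PathAlgebra K V →ₐ[K] Module.End K (Fin (u.length + 1) → K) :=
  RingQuot.liftAlgHom K ⟨FreeAlgebra.lift K (Sum.elim (w.vertexMap K) (w.arrowMap K)), by
    classical
    intro x y h
    cases h with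
    | idem v =>
      refine LinearMap.ext fun x => funext fun i => ?_
      by_cases h1 : w.vertex i = v
      · simp [vertexMap_apply, h1]
      · simp [vertexMap_apply, h1]
    | orth v v' h =>
      refine LinearMap.ext fun x => funext fun i => ?_
      by_cases h1 : w.vertex i = v
      · simp [vertexMap_apply, h1, h]
      · simp [vertexMap_apply, h1]
    | one =>
      refine LinearMap.ext fun x => funext fun i => ?_
      simp [vertexMap_apply, LinearMap.sum_apply, Finset.sum_apply]
    | target a =>
      refine LinearMap.ext fun x => funext fun j => ?_
      simp only [map_mul, FreeAlgebra.lift_ι_apply, Sum.elim_inl, Sum.elim_inr,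
        Module.End.mul_apply, vertexMap_apply, arrowMap_apply]
      split_ifs with hj
      · rfl
      · symm
        refine Finset.sum_eq_zero fun i _ => if_neg ?_
        rintro ⟨rfl, rfl⟩
        exact hj (w.right_letter i).symm
    | source a =>
      refine LinearMap.ext fun x => funext fun j => ?_
      simp only [map_mul, FreeAlgebra.lift_ι_apply, Sum.elim_inl, Sum.elim_inr,
        Module.End.mul_apply, vertexMap_apply, arrowMap_apply]
      refine Finset.sum_congr rfl fun i _ => ?_
      by_cases h : w.letter i = a ∧ headIndex u i = j
      · rw [if_pos h, if_pos h, if_pos]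
        rw [← h.1]; exact (w.left_letter i).symm
      · rw [if_neg h, if_neg h]⟩

/-- The ideal `I` annihilates the string representation, i.e. `M(w)` is a module over `KQ/I`.
(In particular no directed path occurring in `w` or in its inverse lies in `I`; if `I` is generated
by paths, the two conditions are equivalent.) -/
def IsAnnihilatedBy (I : Ideal (PathAlgebra K V)) : Prop :=
  ∀ x ∈ I, w.pathAction K x = 0

end QuiverString

section Modules

variable {K : Type*} [Field K] {V : Type*} [Quiver V] [Fintype V] {u : List Bool}

/-- The string module `M(w)` over `Λ = KQ/I`, with one basis vector per vertex of `w`. -/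
def StringModule (w : QuiverString V u) (I : Ideal (PathAlgebra K V))
    (_ : w.IsAnnihilatedBy K I) : Type _ :=
  Fin (u.length + 1) → K

namespace StringModule

variable (w : QuiverString V u) (I : Ideal (PathAlgebra K V)) (hI : w.IsAnnihilatedBy K I)

instance : AddCommGroup (StringModule w I hI) :=
  inferInstanceAs (AddCommGroup (Fin (u.length + 1) → K))

instance : Module K (StringModule w I hI) :=
  inferInstanceAs (Module K (Fin (u.length + 1) → K))

/-- The basis vector of the string module at the `i`-th vertex of the string. -/
def basisVec (i : Fin (u.length + 1)) : StringModule w I hI :=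
  (Pi.single i 1 : Fin (u.length + 1) → K)

variable [I.IsTwoSided]

/-- The action of `Λ = KQ/I` on the string module. -/
noncomputable def action : (PathAlgebra K V ⧸ I) →ₐ[K] Module.End K (StringModule w I hI) :=
  Ideal.Quotient.liftₐ I (w.pathAction K) hI

noncomputable instance : Module (PathAlgebra K V ⧸ I) (StringModule w I hI) :=
  Module.compHom _ (action w I hI).toRingHom

theorem smul_def (x : PathAlgebra K V ⧸ I) (m : StringModule w I hI) :
    x • m = action w I hI x m := rfl

instance : IsScalarTower K (PathAlgebra K V ⧸ I) (StringModule w I hI) where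
  smul_assoc c x m := by
    simp only [smul_def, map_smul, LinearMap.smul_apply]

end StringModule

end Modules

/-! ### Induced modules -/

/-- The truncated polynomial algebra `K[ε]/(ε^d)`. -/
abbrev TruncPoly (K : Type*) [Field K] (d : ℕ) : Type _ :=
  Polynomial K ⧸ Ideal.span {(Polynomial.X : Polynomial K) ^ d}

/-- The class of `ε` in `K[ε]/(ε^d)`. -/
noncomputable def TruncPoly.eps (K : Type*) [Field K] (d : ℕ) : TruncPoly K d :=
  Ideal.Quotient.mk _ Polynomial.X

/-- The induced module `M ⊗_K K[ε]/(ε^d)` of a `Λ`-module `M`, a module over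
`Λ ⊗_K K[ε]/(ε^d)`. -/
def InducedModule (K : Type*) [Field K] (Λ : Type*) [Ring Λ] [Algebra K Λ] (M : Type*)
    [AddCommGroup M] [Module K M] [Module Λ M] [IsScalarTower K Λ M] (d : ℕ) : Type _ :=
  M ⊗[K] TruncPoly K d

namespace InducedModule

variable (K : Type*) [Field K] (Λ : Type*) [Ring Λ] [Algebra K Λ] (M : Type*)
    [AddCommGroup M] [Module K M] [Module Λ M] [IsScalarTower K Λ M] (d : ℕ)

noncomputable instance : AddCommGroup (InducedModule K Λ M d) :=
  inferInstanceAs (AddCommGroup (M ⊗[K] TruncPoly K d))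

noncomputable instance : Module K (InducedModule K Λ M d) :=
  inferInstanceAs (Module K (M ⊗[K] TruncPoly K d))

/-- The pure tensor `m ⊗ p` as an element of the induced module. -/
noncomputable def tmul (m : M) (p : TruncPoly K d) : InducedModule K Λ M d :=
  (m ⊗ₜ[K] p : M ⊗[K] TruncPoly K d)

/-- The action `(x ⊗ q) • (m ⊗ p) = x m ⊗ q p`. -/
noncomputable def action : (Λ ⊗[K] TruncPoly K d) →ₐ[K] Module.End K (InducedModule K Λ M d) :=
  (Module.endTensorEndAlgHom (R := K) (S := K) (A := K) (M := M) (N := TruncPoly K d)).comp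
    (Algebra.TensorProduct.map (Algebra.lsmul K K M) (Algebra.lmul K (TruncPoly K d)))

noncomputable instance : Module (Λ ⊗[K] TruncPoly K d) (InducedModule K Λ M d) :=
  Module.compHom _ (action K Λ M d).toRingHom

theorem smul_tmul (x : Λ) (q p : TruncPoly K d) (m : M) :
    (x ⊗ₜ[K] q : Λ ⊗[K] TruncPoly K d) • tmul K Λ M d m p = tmul K Λ M d (x • m) (q * p) := rfl

end InducedModule

section InducedString

variable {K : Type*} [Field K] {V : Type*} [Quiver V] [Fintype V] {u : List Bool}

/-- The induced module `M(w) ⊗_K K[ε]/(ε^d)` of a string module. -/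
abbrev InducedStringModule (w : QuiverString V u) (I : Ideal (PathAlgebra K V)) [I.IsTwoSided]
    (hI : w.IsAnnihilatedBy K I) (d : ℕ) : Type _ :=
  InducedModule K (PathAlgebra K V ⧸ I) (StringModule w I hI) d

/-- The submodules, over `Λ ⊗_K K[ε]/(ε^d)`, of the induced module of a string module. -/
abbrev InducedStringSubmodule (w : QuiverString V u) (I : Ideal (PathAlgebra K V)) [I.IsTwoSided]
    (hI : w.IsAnnihilatedBy K I) (d : ℕ) : Type _ :=
  Submodule ((PathAlgebra K V ⧸ I) ⊗[K] TruncPoly K d) (InducedStringModule w I hI d)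

/-- The canonical submodules of the induced module of a string module: the submodules that are
spanned over `K` by some of the standard basis vectors `v_i ⊗ ε^k`. -/
def canonicalSubmodules (w : QuiverString V u) (I : Ideal (PathAlgebra K V)) [I.IsTwoSided]
    (hI : w.IsAnnihilatedBy K I) (d : ℕ) : Set (InducedStringSubmodule w I hI d) :=
  {N | ∃ S : Set (Fin (u.length + 1) × ℕ),
    (N : Set (InducedStringModule w I hI d)) = Submodule.span K
      ((fun p => InducedModule.tmul K (PathAlgebra K V ⧸ I) (StringModule w I hI) d
        (StringModule.basisVec w I hI p.1) (TruncPoly.eps K d ^ p.2)) '' S)}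

end InducedString

/-! ### Transfer matrices -/

/-! All counts reduce to one: the number of labelings of the vertices of the abstract string by `0,
…, d` that increase weakly along the arrows. Read along the string, such a labeling is a walk in `0,
…, d`, so the number is `transferCount`, the sum of all entries of a product of 0/1 matrices, one
per arrow: the upper triangular matrix T of ones for a direct arrow, its transpose for an inverse
one.

Submodules: the ideals of K[ε]/(ε^d) are generated by the ε^k with k ≤ d. A canonical submodule is
the sum of its components v_i ⊗ (ε^(d - h i)), and stability under the arrows says exactly that h
increases weakly (`labelingEquiv`). If the string repeats no vertex, the vertex idempotents cut
every submodule into such components, so every submodule is canonical.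

Dimer covers: let a square be glued along an edge ab. Degree d at the two new corners forces
multiplicities x, d - x, x on the new sides, and trading them for x copies of ab gives exactly the
old covers that contain ab at least x times (`IsSquareExtension.bijOn`). Measure the last tile by
the multiplicity of its North or East side, alternately. These two sides always have total
multiplicity d, so the inequality compares the labels of consecutive tiles in the direction of the
arrow, and each new tile contributes one transfer matrix (`ncard_labelSide_concat`).

Continued fractions: summing Pascal's rule gives Λ_d(a) = T^a R, where R is the reversal i ↦ d - i,
and conjugation by R transposes T. Moving all reversals to the right turns the product of the
Λ_d(a_i) into the transfer product of the sign sequence (`multichooseCol_eq_transferProd`). Its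
first and last signs only supply all-ones vectors, and the inner signs are the arrows of the string
up to a global flip, which does not change the count. The first column of the matrix product obeys
the recursion of the numerators of the higher continued fraction. -/

/-- The matrix of the relation `i ≤ j` (for a direct arrow) or `j ≤ i` (for an inverse arrow)
on `0, …, d`. -/
def transferMatrix (d : ℕ) (b : Bool) : Matrix (Fin (d + 1)) (Fin (d + 1)) ℕ :=
  Matrix.of fun i j => if (if b then i ≤ j else j ≤ i) then 1 else 0

/-- The product of the transfer matrices of an abstract string. -/
def transferProd (d : ℕ) (u : List Bool) : Matrix (Fin (d + 1)) (Fin (d + 1)) ℕ :=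
  (u.map (transferMatrix d)).prod

/-- The sum of all entries of the product of the transfer matrices of an abstract string. -/
def transferCount (d : ℕ) (u : List Bool) : ℕ :=
  ∑ i, (transferProd d u).mulVec 1 i

section Transfer

open Matrix

variable (d : ℕ)

theorem transferMatrix_mulVec (b : Bool) (v : Fin (d + 1) → ℕ) (i : Fin (d + 1)) :
    (transferMatrix d b *ᵥ v) i = ∑ j with (if b then i ≤ j else j ≤ i), v j := by
  simp only [Matrix.mulVec, dotProduct, transferMatrix, of_apply, ite_mul, one_mul, zero_mul,
    Finset.sum_filter]

/-- The reversal i ↦ d - i is an order anti-automorphism, so it exchanges the two relations. -/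
theorem transferMatrix_not_mulVec (b : Bool) (v : Fin (d + 1) → ℕ) :
    transferMatrix d (!b) *ᵥ (v ∘ Fin.rev) = (transferMatrix d b *ᵥ v) ∘ Fin.rev := by
  funext i
  simp only [Function.comp, transferMatrix_mulVec, Finset.sum_filter]
  refine Fintype.sum_equiv Fin.revPerm _ _ fun j => ?_
  cases b <;> simp

theorem transferProd_nil : transferProd d [] = 1 := rfl

theorem transferProd_cons (b : Bool) (u : List Bool) :
    transferProd d (b :: u) = transferMatrix d b * transferProd d u := by
  simp [transferProd]

theorem transferProd_append (u u' : List Bool) :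
    transferProd d (u ++ u') = transferProd d u * transferProd d u' := by
  simp [transferProd]

theorem transferProd_replicate (b : Bool) (k : ℕ) :
    transferProd d (List.replicate k b) = transferMatrix d b ^ k := by
  simp [transferProd]

theorem transferProd_map_not_mulVec (u : List Bool) (v : Fin (d + 1) → ℕ) :
    transferProd d (u.map not) *ᵥ (v ∘ Fin.rev) = (transferProd d u *ᵥ v) ∘ Fin.rev := by
  induction u with
  | nil => simp [transferProd_nil]
  | cons b u ih =>
    rw [List.map_cons, transferProd_cons, transferProd_cons, ← mulVec_mulVec, ← mulVec_mulVec, ih,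
      transferMatrix_not_mulVec]

/-- Reversing the labels permutes the row sums, hence preserves their total. This is why the global
sign of a sign function is irrelevant. -/
theorem transferCount_map_not (u : List Bool) :
    transferCount d (u.map not) = transferCount d u := by
  have h := transferProd_map_not_mulVec d u 1
  have h1 : (1 : Fin (d + 1) → ℕ) ∘ Fin.rev = 1 := rfl
  rw [h1] at h
  rw [transferCount, transferCount, h]
  exact Fintype.sum_equiv Fin.revPerm _ _ fun _ => rfl

/-! ### Multichoose matrices as powers of a transfer matrix times the reversal -/

theorem multichoose_recurrence (a i j : ℕ) :
    (if i + j ≤ d then Nat.multichoose (a + 1) (d - i - j) else 0) =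
      (if i + j ≤ d then Nat.multichoose a (d - i - j) else 0) +
        if i + 1 + j ≤ d then Nat.multichoose (a + 1) (d - (i + 1) - j) else 0 := by
  by_cases h : i + 1 + j ≤ d
  · obtain ⟨k, hk⟩ : ∃ k, d - (i + 1) - j = k := ⟨_, rfl⟩
    have hk' : d - i - j = k + 1 := by omega
    rw [if_pos h, if_pos (by omega), if_pos (by omega), hk, hk', Nat.multichoose_succ_succ]
  · rw [if_neg h]
    by_cases h' : i + j ≤ d
    · have : d - i - j = 0 := by omega
      simp [h', this]
    · simp [h']

/-- Hockey-stick identity: the recurrence telescopes, by descending induction from the empty sum at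
`i = d + 1`. -/
theorem sum_Ico_multichoose (a j i : ℕ) (hi : i ≤ d + 1) :
    ∑ k ∈ Finset.Ico i (d + 1), (if k + j ≤ d then Nat.multichoose a (d - k - j) else 0) =
      if i + j ≤ d then Nat.multichoose (a + 1) (d - i - j) else 0 := by
  induction hi using Nat.decreasingInduction with
  | self => simp [show ¬ d + 1 + j ≤ d by omega]
  | of_succ i hi ih =>
    rw [Finset.sum_eq_sum_Ico_succ_bot (by omega), ih, multichoose_recurrence d a i j]

theorem multichooseMatrix_succ (a : ℕ) :
    multichooseMatrix d (a + 1) = transferMatrix d true * multichooseMatrix d a := by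
  ext i j
  rw [Matrix.mul_apply]
  simp only [multichooseMatrix, transferMatrix, of_apply, if_true, ite_mul, one_mul, zero_mul]
  rw [← sum_Ico_multichoose d a j i (by omega)]
  simp only [Fin.le_def]
  rw [Fin.sum_univ_eq_sum_range (fun k => if (i : ℕ) ≤ k then
      (if k + (j : ℕ) ≤ d then Nat.multichoose a (d - k - j) else 0) else 0) (d + 1),
    ← Finset.sum_filter (fun k => (i : ℕ) ≤ k)]
  refine Finset.sum_congr ?_ fun _ _ => rfl
  ext k
  simp only [Finset.mem_Ico, Finset.mem_filter, Finset.mem_range]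
  omega

/-- An empty set has only the empty multiset, so the entries survive only on the antidiagonal i + j
= d. -/
theorem multichooseMatrix_zero_mulVec (v : Fin (d + 1) → ℕ) :
    multichooseMatrix d 0 *ᵥ v = v ∘ Fin.rev := by
  funext i
  simp only [Matrix.mulVec, dotProduct, multichooseMatrix, of_apply, Function.comp]
  rw [Finset.sum_eq_single i.rev]
  · rw [if_pos (by rw [Fin.val_rev]; omega), show d - (i : ℕ) - i.rev = 0 by
      rw [Fin.val_rev]; omega]
    simp
  · intro j _ hj
    split_ifs with h
    · obtain ⟨k, hk⟩ : ∃ k, d - (i : ℕ) - j = k + 1 := by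
        refine ⟨d - i - j - 1, ?_⟩
        have : (j : ℕ) ≠ d - i := fun h' => hj (Fin.ext (by rw [Fin.val_rev]; omega))
        omega
      rw [hk, Nat.multichoose_zero_succ, zero_mul]
    · simp
  · simp

theorem multichooseMatrix_mulVec (a : ℕ) (v : Fin (d + 1) → ℕ) :
    multichooseMatrix d a *ᵥ v = transferMatrix d true ^ a *ᵥ (v ∘ Fin.rev) := by
  induction a with
  | zero => rw [multichooseMatrix_zero_mulVec, pow_zero, one_mulVec]
  | succ a ih => rw [multichooseMatrix_succ, ← mulVec_mulVec, ih, mulVec_mulVec, pow_succ']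

/-! ### The first column and the sign sequence -/

/-- The first column of the product of the matrices of a list. -/
def multichooseCol (a : List ℕ) : Fin (d + 1) → ℕ :=
  (a.map (multichooseMatrix d)).prod *ᵥ Pi.single 0 1

theorem multichooseCol_cons (k : ℕ) (a : List ℕ) :
    multichooseCol d (k :: a) = multichooseMatrix d k *ᵥ multichooseCol d a := by
  rw [multichooseCol, multichooseCol, mulVec_mulVec, List.map_cons, List.prod_cons]

theorem multichooseCol_nil : multichooseCol d [] = Pi.single 0 1 := by
  rw [multichooseCol, List.map_nil, List.prod_nil, one_mulVec]

theorem multichooseCol_apply (a : List ℕ) (i : Fin (d + 1)) :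
    multichooseCol d a i = (a.map (multichooseMatrix d)).prod i 0 := by
  simp [multichooseCol]

/-- Every label is comparable with the extreme one in the required direction. This absorbs the last
sign of a sign sequence. -/
theorem transferMatrix_mulVec_single (b : Bool) :
    transferMatrix d b *ᵥ (if b then Pi.single (Fin.last d) 1 else Pi.single 0 1) = 1 := by
  funext i
  cases b <;> simp [transferMatrix, Fin.le_last]

theorem comp_rev_rev (v : Fin (d + 1) → ℕ) : (v ∘ Fin.rev) ∘ Fin.rev = v := by
  funext i; simp

theorem transferMatrix_pow_comp_rev (k : ℕ) (v : Fin (d + 1) → ℕ) :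
    (transferMatrix d true ^ k *ᵥ v) ∘ Fin.rev = transferMatrix d false ^ k *ᵥ (v ∘ Fin.rev) := by
  have h := transferProd_map_not_mulVec d (List.replicate k true) v
  rw [List.map_replicate, transferProd_replicate, transferProd_replicate] at h
  exact h.symm

theorem single_zero_comp_rev :
    (Pi.single 0 1 : Fin (d + 1) → ℕ) ∘ Fin.rev = Pi.single (Fin.last d) 1 := by
  funext i
  simp only [Function.comp, Pi.single_apply, Fin.rev_eq_iff, Fin.rev_zero]

theorem signSequence_ne_nil {a : List ℕ} (ha : a ≠ []) (hpos : ∀ k ∈ a, 0 < k) (b : Bool) :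
    signSequence a b ≠ [] := by
  cases a with
  | nil => exact absurd rfl ha
  | cons k a => simp [signSequence, (hpos k (by simp)).ne']

/-- Each block contributes T^k R, and R transposes the transfer matrices of all later blocks,
matching the alternation of signs. The reversal on the left records the starting sign. -/
theorem multichooseCol_eq_transferProd (a : List ℕ) (ha : a ≠ []) (hpos : ∀ k ∈ a, 0 < k)
    (b : Bool) :
    (if b then multichooseCol d a else multichooseCol d a ∘ Fin.rev) =
      transferProd d (signSequence a b).dropLast *ᵥ 1 := by
  induction a generalizing b with
  | nil => exact absurd rfl ha
  | cons k a ih =>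
    rw [multichooseCol_cons, multichooseMatrix_mulVec]
    by_cases hna : a = []
    · subst hna
      obtain ⟨k, rfl⟩ := Nat.exists_eq_succ_of_ne_zero (hpos k (by simp)).ne'
      rw [transferMatrix_pow_comp_rev, comp_rev_rev, multichooseCol_nil, single_zero_comp_rev]
      have hs : ∀ v, transferMatrix d b ^ k.succ *ᵥ v =
          transferMatrix d b ^ k *ᵥ (transferMatrix d b *ᵥ v) := fun v => by
        rw [mulVec_mulVec, Nat.succ_eq_add_one, pow_succ]
      have h1 := transferMatrix_mulVec_single d b
      simp only [signSequence, List.append_nil, List.dropLast_replicate, transferProd_replicate,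
        Nat.succ_sub_one]
      cases b
      · simpa [hs] using congrArg (transferMatrix d false ^ k *ᵥ ·) h1
      · simpa [hs] using congrArg (transferMatrix d true ^ k *ᵥ ·) h1
    · have hpos' : ∀ k ∈ a, 0 < k := fun k hk => hpos k (by simp [hk])
      have h := ih hna hpos' (!b)
      rw [signSequence, List.dropLast_append_of_ne_nil (signSequence_ne_nil hna hpos' _),
        transferProd_append, transferProd_replicate, ← mulVec_mulVec, ← h,
        transferMatrix_pow_comp_rev, comp_rev_rev]
      cases b <;> simp

theorem signSequence_head {a : List ℕ} (hpos : ∀ k ∈ a, 0 < k) {b x : Bool} {l : List Bool}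
    (h : signSequence a b = x :: l) : x = b := by
  cases a with
  | nil => simp [signSequence] at h
  | cons k a =>
    obtain ⟨k, rfl⟩ := Nat.exists_eq_succ_of_ne_zero (hpos k (by simp)).ne'
    rw [signSequence, List.replicate_succ, List.cons_append, List.cons.injEq] at h
    exact h.1.symm

/-- The top left entry of the product of the matrices is determined by the sign sequence without
its first and last sign. -/
theorem prod_multichooseMatrix_eq_transferCount {a : List ℕ} (hpos : ∀ k ∈ a, 0 < k)
    {b x y : Bool} {l : List Bool} (h : signSequence a b = x :: (l ++ [y])) :
    (a.map (multichooseMatrix d)).prod 0 0 = transferCount d l := by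
  have ha : a ≠ [] := by rintro rfl; simp [signSequence] at h
  have hx := signSequence_head hpos h
  subst hx
  have h1 := multichooseCol_eq_transferProd d a ha hpos x
  rw [h, ← List.cons_append, List.dropLast_concat, transferProd_cons, ← mulVec_mulVec] at h1
  rw [← multichooseCol_apply, transferCount]
  cases x
  -- The row of the first sign that consists of ones is the last one for an inverse arrow and the
  -- row `0` for a direct one; evaluating there sums all entries.
  · have h2 := congrFun h1 (Fin.last d)
    rw [transferMatrix_mulVec] at h2
    simpa [Fin.le_last] using h2
  · have h2 := congrFun h1 0
    rw [transferMatrix_mulVec] at h2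
    simpa using h2

/-! ### Higher continued fractions -/

theorem multichoose_pos {k : ℕ} (hk : 0 < k) (i : ℕ) : 0 < Nat.multichoose k i := by
  rw [Nat.multichoose_eq]
  exact Nat.choose_pos (by omega)

/-- The row d - i of Λ_d(k) has the entries multichoose(k, i - j) for j ≤ i and 0 beyond, so the
recursion of the numerators is a matrix-vector product with reversed indices. The leading term of
the recursion is the summand j = 0. -/
theorem higherCFNum_eq_multichooseCol (a : List ℕ) (ha : a ≠ []) (i : Fin (d + 1)) :
    higherCFNum d a i = multichooseCol d a i.rev := by
  induction a generalizing i with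
  | nil => exact absurd rfl ha
  | cons k a ih =>
    have hi := i.isLt
    rw [multichooseCol_cons]
    cases a with
    | nil =>
      rw [higherCFNum, multichooseCol_nil]
      simp only [mulVec_single, multichooseMatrix, MulOpposite.op_one, one_smul, col_apply,
        of_apply]
      rw [if_pos (by rw [Fin.val_rev, Fin.val_zero]; omega)]
      congr 1
      rw [Fin.val_rev, Fin.val_zero]
      omega
    | cons b l =>
      have ih' : ∀ j ≤ d, higherCFNum d (b :: l) (d - j) =
          if h : j < d + 1 then multichooseCol d (b :: l) ⟨j, h⟩ else 0 := fun j hj => by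
        rw [dif_pos (by omega)]
        convert ih (by simp) (Fin.rev ⟨j, by omega⟩) using 1
        · simp [Fin.val_rev]
        · simp
      have h1 : higherCFNum d (k :: b :: l) i = ∑ j ∈ Finset.range (i + 1),
          Nat.multichoose k (i - j) * higherCFNum d (b :: l) (d - j) := by
        rw [higherCFNum, Finset.sum_range_eq_add_Ico _ (by omega)]
        rfl
      rw [h1, Matrix.mulVec, dotProduct]
      have h2 : ∀ j : Fin (d + 1), multichooseMatrix d k i.rev j * multichooseCol d (b :: l) j =
          (fun j : ℕ => if j ∈ Finset.range (i + 1) then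
            Nat.multichoose k (i - j) * higherCFNum d (b :: l) (d - j) else 0) j := by
        intro j
        simp only [multichooseMatrix, of_apply, Fin.val_rev, Finset.mem_range]
        by_cases hj : (j : ℕ) < i + 1
        · rw [if_pos hj, if_pos (by omega), ih' j (by omega), dif_pos j.isLt,
            show d - (d + 1 - ((i : ℕ) + 1)) - j = i - j by omega]
        · rw [if_neg hj, if_neg (by omega), zero_mul]
      rw [Fintype.sum_congr _ _ h2, Fin.sum_univ_eq_sum_range (fun j : ℕ =>
        if j ∈ Finset.range (i + 1) then
          Nat.multichoose k (i - j) * higherCFNum d (b :: l) (d - j) else 0), ← Finset.sum_filter]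
      refine Finset.sum_congr ?_ fun _ _ => rfl
      ext j
      simp only [Finset.mem_filter, Finset.mem_range]
      omega

theorem higherCFNum_eq_prod (a : List ℕ) (ha : a ≠ []) :
    higherCFNum d a d = (a.map (multichooseMatrix d)).prod 0 0 := by
  rw [← multichooseCol_apply]
  simpa using higherCFNum_eq_multichooseCol d a ha (Fin.last d)

theorem higherCFNum_pos (a : List ℕ) (hpos : ∀ k ∈ a, 0 < k) (i : ℕ) :
    0 < higherCFNum d a i := by
  induction a generalizing i with
  | nil => exact one_pos
  | cons k a ih =>
    cases a with
    | nil => exact multichoose_pos (hpos k (by simp)) i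
    | cons b l =>
      exact Nat.add_pos_left (Nat.mul_pos (multichoose_pos (hpos k (by simp)) i)
        (ih (fun k hk => hpos k (by simp [hk])) d)) _

theorem higherCFDen_pos (a : List ℕ) (hpos : ∀ k ∈ a, 0 < k) : 0 < higherCFDen d a := by
  match a with
  | [] => exact one_pos
  | [_] => exact one_pos
  | _ :: b :: l => exact higherCFNum_pos d (b :: l) (fun k hk => hpos k (List.mem_cons_of_mem _ hk)) d

/-- All entries of the tail share one denominator, so it cancels in the quotients r_(d-j) / r_d and
only numerators remain. -/
theorem higherCF_eq_num_div_den (a : List ℕ) (hpos : ∀ k ∈ a, 0 < k) (i : ℕ) :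
    higherCF d a i = (higherCFNum d a i : ℚ) / (higherCFDen d a : ℚ) := by
  induction a generalizing i with
  | nil => simp [higherCF, higherCFNum, higherCFDen]
  | cons k a ih =>
    cases a with
    | nil => simp [higherCF, higherCFNum, higherCFDen]
    | cons b l =>
      have hpos' : ∀ k ∈ b :: l, 0 < k := fun k hk => hpos k (List.mem_cons_of_mem _ hk)
      have hd : (higherCFDen d (b :: l) : ℚ) ≠ 0 := by
        exact_mod_cast (higherCFDen_pos d _ hpos').ne'
      have hn : (higherCFNum d (b :: l) d : ℚ) ≠ 0 := by
        exact_mod_cast (higherCFNum_pos d _ hpos' d).ne'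
      have hden : higherCFDen d (k :: b :: l) = higherCFNum d (b :: l) d := rfl
      rw [hden, higherCF, higherCFNum, eq_div_iff hn]
      push_cast
      rw [add_mul, Finset.sum_mul]
      congr 1
      refine Finset.sum_congr rfl fun j _ => ?_
      rw [ih hpos', ih hpos']
      field_simp

end Transfer

/-! ### Monotone labelings of an abstract string -/

/-- The labelings of the vertices of an abstract string by `0, …, d` that increase weakly along
every arrow. -/
def monotoneLabelings (d : ℕ) (u : List Bool) : Set (Fin (u.length + 1) → Fin (d + 1)) :=
  {h | ∀ i, h (tailIndex u i) ≤ h (headIndex u i)}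

theorem tailIndex_cons_succ (b : Bool) (u : List Bool) (i : Fin u.length) :
    tailIndex (b :: u) i.succ = (tailIndex u i).succ := by
  change (if u.get i then i.succ.castSucc else i.succ.succ) = _
  rw [tailIndex]
  split <;> rfl

theorem headIndex_cons_succ (b : Bool) (u : List Bool) (i : Fin u.length) :
    headIndex (b :: u) i.succ = (headIndex u i).succ := by
  change (if u.get i then i.succ.succ else i.succ.castSucc) = _
  rw [headIndex]
  split <;> rfl

theorem cons_mem_monotoneLabelings (d : ℕ) (b : Bool) (u : List Bool) (x : Fin (d + 1))
    (t : Fin (u.length + 1) → Fin (d + 1)) :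
    (Fin.cons x t : Fin (u.length + 1 + 1) → Fin (d + 1)) ∈ monotoneLabelings d (b :: u) ↔
      (if b then x ≤ t 0 else t 0 ≤ x) ∧ t ∈ monotoneLabelings d u := by
  have h : ∀ c : Fin (u.length + 1 + 1) → Fin (d + 1), c ∈ monotoneLabelings d (b :: u) ↔
      c (tailIndex (b :: u) (0 : Fin (u.length + 1))) ≤
          c (headIndex (b :: u) (0 : Fin (u.length + 1))) ∧
        ∀ i : Fin u.length, c (tailIndex u i).succ ≤ c (headIndex u i).succ := fun c => by
    simp only [← tailIndex_cons_succ b, ← headIndex_cons_succ b]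
    exact Fin.forall_fin_succ
  rw [h]
  simp only [Fin.cons_succ]
  refine and_congr ?_ Iff.rfl
  cases b
  · exact Iff.rfl
  · exact Iff.rfl

-- Row sums of the transfer product count the labelings with prescribed first label; each further
-- letter sums over the admissible second labels.
open Classical in
theorem sum_cons_monotoneLabelings (d : ℕ) (u : List Bool) (x : Fin (d + 1)) :
    (∑ t : Fin u.length → Fin (d + 1),
      if (Fin.cons x t : Fin (u.length + 1) → Fin (d + 1)) ∈ monotoneLabelings d u then 1 else 0) =
      (transferProd d u).mulVec 1 x := by
  induction u generalizing x with
  | nil =>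
    have : ∀ c, c ∈ monotoneLabelings d [] := fun c i => i.elim0
    simp [this, transferProd_nil]
  | cons b u ih =>
    rw [transferProd_cons, ← Matrix.mulVec_mulVec, transferMatrix_mulVec, Finset.sum_filter]
    simp only [← ih, cons_mem_monotoneLabelings]
    refine ((Fin.consEquiv fun _ : Fin (u.length + 1) => Fin (d + 1)).sum_comp _).symm.trans ?_
    rw [Fintype.sum_prod_type]
    refine Finset.sum_congr rfl fun y _ => ?_
    simp only [Fin.consEquiv_apply, Fin.cons_zero, ite_and]
    split_ifs <;> simp <;> rfl

theorem ncard_monotoneLabelings (d : ℕ) (u : List Bool) :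
    (monotoneLabelings d u).ncard = transferCount d u := by
  classical
  simp only [transferCount, ← sum_cons_monotoneLabelings]
  rw [← Fintype.sum_prod_type', Set.ncard_eq_toFinset_card', Finset.card_eq_sum_ones,
    ← Set.filter_mem_univ_eq_toFinset, Finset.sum_filter]
  exact ((Fin.consEquiv fun _ : Fin (u.length + 1) => Fin (d + 1)).sum_comp _).symm

/-! ### The arrows of the abstract string -/

/-- An arrow is the direction of its step twisted by the parity of its position. At a turn both
change and the arrow persists; on a straight piece only the parity changes and the arrow flips. -/
theorem abstractStringAux_eq_mapIdx (p : SnakeStep) (k : ℕ) (l : List SnakeStep) :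
    abstractStringAux p (decide (p = SnakeStep.right) ^^ k.bodd) l =
      l.mapIdx fun i q => decide (q = SnakeStep.right) ^^ (i + (k + 1)).bodd := by
  induction l generalizing p k with
  | nil => simp [abstractStringAux]
  | cons q l ih =>
    have hc : (if q = p then !(decide (p = SnakeStep.right) ^^ k.bodd)
        else (decide (p = SnakeStep.right) ^^ k.bodd)) =
        (decide (q = SnakeStep.right) ^^ (k + 1).bodd) := by
      rw [Nat.bodd_succ]
      cases p <;> cases q <;> cases k.bodd <;> rfl
    rw [abstractStringAux, List.mapIdx_cons]
    simp only [hc, ih, zero_add]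
    congr 2
    funext i q
    rw [show i + 1 + (k + 1) = i + (k + 1 + 1) by ring]

theorem abstractString_eq_mapIdx (s : List SnakeStep) :
    abstractString s = s.mapIdx fun i q => decide (q = SnakeStep.right) ^^ i.bodd := by
  cases s with
  | nil => rfl
  | cons p l =>
    rw [abstractString, List.mapIdx_cons]
    have := abstractStringAux_eq_mapIdx p 0 l
    simp only [Nat.bodd_zero, Bool.xor_false] at this ⊢
    rw [this]

theorem abstractString_concat (s : List SnakeStep) (q : SnakeStep) :
    abstractString (s ++ [q]) =
      abstractString s ++ [decide (q = SnakeStep.right) ^^ s.length.bodd] := by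
  simp [abstractString_eq_mapIdx, List.mapIdx_append]

/-! ### The signs of the interior edges -/

theorem tileCorner_succ (s : List SnakeStep) (i : Fin s.length) :
    tileCorner s (i + 1) = tileCorner s i +
      match s.get i with
      | SnakeStep.right => (1, 0)
      | SnakeStep.up => (0, 1) := by
  simp only [tileCorner, List.take_add_one, List.getElem?_eq_getElem i.isLt, Option.toList_some,
    List.count_append, List.get_eq_getElem]
  cases s[(i : ℕ)] <;> rfl

theorem westSide_succ (s : List SnakeStep) (i : Fin s.length) (h : s.get i = SnakeStep.right) :
    westSide s (i + 1) = eastSide s i := by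
  rw [westSide, eastSide, tileCorner_succ, h, add_assoc]
  rfl

theorem southSide_succ (s : List SnakeStep) (i : Fin s.length) (h : s.get i = SnakeStep.up) :
    southSide s (i + 1) = northSide s i := by
  rw [southSide, northSide, tileCorner_succ, h, add_assoc]
  rfl

/-- North signs alternate from tile to tile: the edge shared with the previous tile is West and
East, or South and North, of the two tiles, and either way the sign is reversed once. -/
theorem IsSignFunction.northSide_eq {s : List SnakeStep} {f : Sym2 (ℕ × ℕ) → Bool}
    (hf : IsSignFunction s f) (i : ℕ) (hi : i ≤ s.length) :
    f (northSide s i) = (f (northSide s 0) ^^ i.bodd) := by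
  induction i with
  | zero => simp
  | succ i ih =>
    obtain ⟨h1, h2, h3⟩ := hf i (by omega)
    obtain ⟨h1', h2', h3'⟩ := hf (i + 1) hi
    rw [Nat.bodd_succ]
    have ih := ih (by omega)
    have hw := westSide_succ s ⟨i, by omega⟩
    have hs := southSide_succ s ⟨i, by omega⟩
    have : f (northSide s (i + 1)) ≠ f (northSide s i) := by
      cases h : s.get ⟨i, by omega⟩ with
      | right => rw [h1', hw h, ← h2]; exact h3.symm
      | up => rw [← hs h]; exact h3'
    rw [ih] at this
    revert this
    cases f (northSide s (i + 1)) <;> cases f (northSide s 0) <;> cases i.bodd <;> simp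

/-- An interior edge is a North or an East side, and these two have opposite signs. Hence its sign
is the direction of the step twisted by the parity of the tile, the same rule as for the arrows. -/
theorem IsSignFunction.interiorEdge_eq {s : List SnakeStep} {f : Sym2 (ℕ × ℕ) → Bool}
    (hf : IsSignFunction s f) :
    List.ofFn (fun i => f (interiorEdge s i)) =
      (abstractString s).map (f (northSide s 0) ^^ ·) := by
  rw [abstractString_eq_mapIdx]
  refine List.ext_getElem (by simp) fun i h1 h2 => ?_
  have hi : i < s.length := by simpa using h1
  obtain ⟨-, h4, h5⟩ := hf i (by omega)
  have h3 := hf.northSide_eq i (by omega)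
  rw [h4, h3] at h5
  simp only [List.getElem_ofFn, List.getElem_map, List.getElem_mapIdx, interiorEdge]
  cases h : s.get ⟨i, hi⟩ with
  | right =>
    rw [List.get_eq_getElem] at h
    simp only [h]
    revert h5
    cases f (eastSide s i) <;> cases f (northSide s 0) <;> cases i.bodd <;> simp
  | up =>
    rw [List.get_eq_getElem] at h
    simp only [h, h3]
    simp

theorem transferCount_abstractString (d : ℕ) {s : List SnakeStep} {a : List ℕ}
    (h : IsSnakeGraphOfCF s a) :
    transferCount d (abstractString s) = (a.map (multichooseMatrix d)).prod 0 0 := by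
  obtain ⟨hpos, f, hf, e, e', -, -, b, hb⟩ := h
  rw [prod_multichooseMatrix_eq_transferCount d hpos hb, hf.interiorEdge_eq]
  cases f (northSide s 0)
  · simp
  · rw [← transferCount_map_not]
    congr 1
    refine List.map_congr_left fun x _ => ?_
    simp

theorem IsSnakeGraphOfCF.ne_nil {s : List SnakeStep} {a : List ℕ} (h : IsSnakeGraphOfCF s a) :
    a ≠ [] := by
  rintro rfl
  obtain ⟨-, f, -, e, e', -, -, b, hb⟩ := h
  simp [signSequence] at hb

/-! ### Dimer covers under gluing of a square -/

theorem Multiset.countP_replicate_eq {α : Type*} (p : α → Prop) [DecidablePred p] (n : ℕ) (a : α) :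
    (Multiset.replicate n a).countP p = if p a then n else 0 := by
  induction n with
  | zero => simp
  | succ n ih =>
    rw [Multiset.replicate_succ, Multiset.countP_cons, ih]
    split_ifs <;> rfl

theorem SimpleGraph.mem_support_iff_exists_mem_edgeSet {W : Type*} (G : SimpleGraph W) (v : W) :
    v ∈ G.support ↔ ∃ e ∈ G.edgeSet, v ∈ e := by
  rw [SimpleGraph.mem_support]
  constructor
  · rintro ⟨w, h⟩
    exact ⟨s(v, w), h, by simp⟩
  · rintro ⟨e, he, w, rfl⟩
    exact ⟨w, he⟩

/-- The graph `G'` arises from `G` by gluing a square with corners `a, b, b', a'` along the edge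
`ab` of `G`. -/
structure IsSquareExtension {W : Type*} (G G' : SimpleGraph W) (a b a' b' : W) : Prop where
  adj : G.Adj a b
  left_notMem : a' ∉ G.support
  right_notMem : b' ∉ G.support
  ne : a' ≠ b'
  mem_edgeSet : ∀ e, e ∈ G'.edgeSet ↔
    e ∈ G.edgeSet ∨ e = s(a, a') ∨ e = s(b, b') ∨ e = s(a', b')

namespace IsSquareExtension

variable {W : Type*} {G G' : SimpleGraph W} {a b a' b' : W}

theorem notMem_edge (h : IsSquareExtension G G' a b a' b') {e : Sym2 W} (he : e ∈ G.edgeSet) :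
    a' ∉ e ∧ b' ∉ e :=
  ⟨fun h' => h.left_notMem ((G.mem_support_iff_exists_mem_edgeSet _).2 ⟨e, he, h'⟩),
    fun h' => h.right_notMem ((G.mem_support_iff_exists_mem_edgeSet _).2 ⟨e, he, h'⟩)⟩

theorem edge_notMem (h : IsSquareExtension G G' a b a' b') :
    s(a, a') ∉ G.edgeSet ∧ s(b, b') ∉ G.edgeSet ∧ s(a', b') ∉ G.edgeSet :=
  ⟨fun he => (h.notMem_edge he).1 (by simp), fun he => (h.notMem_edge he).2 (by simp),
    fun he => (h.notMem_edge he).1 (by simp)⟩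

theorem corners_ne (h : IsSquareExtension G G' a b a' b') :
    a ≠ b ∧ a ≠ a' ∧ a ≠ b' ∧ b ≠ a' ∧ b ≠ b' ∧ a' ≠ b' := by
  have h1 := h.notMem_edge ((SimpleGraph.mem_edgeSet G).2 h.adj)
  simp only [Sym2.mem_iff, not_or] at h1
  exact ⟨h.adj.ne, Ne.symm h1.1.1, Ne.symm h1.2.1, Ne.symm h1.1.2, Ne.symm h1.2.2, h.ne⟩

theorem edges_ne (h : IsSquareExtension G G' a b a' b') :
    s(a, a') ≠ s(b, b') ∧ s(a, a') ≠ s(a', b') ∧ s(b, b') ≠ s(a', b') := by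
  obtain ⟨h1, h2, h3, h4, h5, h6⟩ := h.corners_ne
  simp [h1, h2, h3, h4, h5, h6, h4.symm]

theorem mem_support (h : IsSquareExtension G G' a b a' b') (v : W) :
    v ∈ G'.support ↔ v ∈ G.support ∨ v = a' ∨ v = b' := by
  have ha : a ∈ G.support := G.mem_support.2 ⟨b, h.adj⟩
  have hb : b ∈ G.support := G.mem_support.2 ⟨a, h.adj.symm⟩
  simp only [G'.mem_support_iff_exists_mem_edgeSet, h.mem_edgeSet]
  constructor
  · rintro ⟨e, he | rfl | rfl | rfl, hv⟩
    · exact Or.inl ((G.mem_support_iff_exists_mem_edgeSet v).2 ⟨e, he, hv⟩)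
    all_goals
      rcases Sym2.mem_iff.1 hv with rfl | rfl <;> simp [ha, hb]
  · rintro (hv | rfl | rfl)
    · obtain ⟨e, he, hv⟩ := (G.mem_support_iff_exists_mem_edgeSet v).1 hv
      exact ⟨e, Or.inl he, hv⟩
    · exact ⟨_, Or.inr (Or.inl rfl), by simp⟩
    · exact ⟨_, Or.inr (Or.inr (Or.inl rfl)), by simp⟩

variable [DecidableEq W]

-- A cover of the larger graph is determined by its old part and the multiplicities of the three new
-- sides.
open Classical in
theorem eq_filter_add (h : IsSquareExtension G G' a b a' b') {D : Multiset (Sym2 W)}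
    (hD : ∀ e ∈ D, e ∈ G'.edgeSet) :
    D = D.filter (· ∈ G.edgeSet) + (Multiset.replicate (D.count s(a, a')) s(a, a') +
      Multiset.replicate (D.count s(b, b')) s(b, b') +
      Multiset.replicate (D.count s(a', b')) s(a', b')) := by
  obtain ⟨n1, n2, n3⟩ := h.edge_notMem
  obtain ⟨e1, e2, e3⟩ := h.edges_ne
  ext e
  simp only [Multiset.count_add, Multiset.count_filter, Multiset.count_replicate]
  by_cases he : e ∈ G'.edgeSet
  · rcases (h.mem_edgeSet e).1 he with he | rfl | rfl | rfl
    · have m1 : s(a, a') ≠ e := fun h' => n1 (h' ▸ he)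
      have m2 : s(b, b') ≠ e := fun h' => n2 (h' ▸ he)
      have m3 : s(a', b') ≠ e := fun h' => n3 (h' ▸ he)
      simp only [he, m1, m2, m3, if_true, if_false, add_zero]
    · simp only [n1, e1.symm, e2.symm, if_true, if_false, add_zero, zero_add]
    · simp only [n2, e1, e3.symm, if_true, if_false, add_zero, zero_add]
    · simp only [n3, e2, e3, if_true, if_false, zero_add]
  · have h0 : e ∉ D := fun h' => he (hD e h')
    rw [Multiset.count_eq_zero_of_notMem h0]
    have h1 : e ∉ G.edgeSet := fun h' => he ((h.mem_edgeSet e).2 (Or.inl h'))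
    have m1 : s(a, a') ≠ e := fun h' => he ((h.mem_edgeSet e).2 (by simp [h']))
    have m2 : s(b, b') ≠ e := fun h' => he ((h.mem_edgeSet e).2 (by simp [h']))
    have m3 : s(a', b') ≠ e := fun h' => he ((h.mem_edgeSet e).2 (by simp [h']))
    simp only [h1, m1, m2, m3, if_false, add_zero]

theorem countP_eq_zero (h : IsSquareExtension G G' a b a' b') {D : Multiset (Sym2 W)}
    (hD : ∀ e ∈ D, e ∈ G.edgeSet) :
    D.countP (fun e => a' ∈ e) = 0 ∧ D.countP (fun e => b' ∈ e) = 0 :=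
  ⟨Multiset.countP_eq_zero.2 fun e he => (h.notMem_edge (hD e he)).1,
    Multiset.countP_eq_zero.2 fun e he => (h.notMem_edge (hD e he)).2⟩

/-- In a dimer cover of the extended graph, the two new sides adjacent to the old graph have equal
multiplicities, complementary to that of the opposite side. -/
theorem count_add_count (h : IsSquareExtension G G' a b a' b') {d : ℕ} {D : Multiset (Sym2 W)}
    (hD : D ∈ dimerCovers G' d) :
    D.count s(a, a') + D.count s(a', b') = d ∧ D.count s(b, b') + D.count s(a', b') = d := by
  classical
  obtain ⟨h1, h2, h3, h4, h5, h6⟩ := h.corners_ne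
  have hd := h.eq_filter_add hD.1
  have hz := h.countP_eq_zero (D := D.filter (· ∈ G.edgeSet)) fun e he =>
    (Multiset.mem_filter.1 he).2
  constructor
  · have := hD.2 a' ((h.mem_support a').2 (by simp))
    rw [hd] at this
    simpa [Multiset.countP_replicate_eq, hz, h2.symm, h4.symm, h6] using this
  · have := hD.2 b' ((h.mem_support b').2 (by simp))
    rw [hd] at this
    simpa [Multiset.countP_replicate_eq, hz, h3.symm, h5.symm, h6.symm] using this

/-- Dimer covers of the extended graph with multiplicity `d - x` on the side opposite to the old
graph correspond to dimer covers of the old graph with multiplicity at least `x` on the common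
edge. -/
theorem bijOn (h : IsSquareExtension G G' a b a' b') {d x : ℕ} (hx : x ≤ d) :
    Set.BijOn (fun D : Multiset (Sym2 W) => D - Multiset.replicate x s(a, b) +
        (Multiset.replicate x s(a, a') + Multiset.replicate x s(b, b') +
          Multiset.replicate (d - x) s(a', b')))
      {D | D ∈ dimerCovers G d ∧ x ≤ D.count s(a, b)}
      {D | D ∈ dimerCovers G' d ∧ D.count s(a', b') = d - x} := by
  classical
  obtain ⟨h1, h2, h3, h4, h5, h6⟩ := h.corners_ne
  obtain ⟨n1, n2, n3⟩ := h.edge_notMem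
  obtain ⟨e1, e2, e3⟩ := h.edges_ne
  have hab : s(a, b) ∈ G.edgeSet := h.adj
  refine ⟨?_, ?_, ?_⟩
  · rintro D ⟨hD, hc⟩
    -- Splitting off the `x` copies of `ab` makes the truncated subtraction exact.
    obtain ⟨E, rfl⟩ := Multiset.le_iff_exists_add.1 (Multiset.le_count_iff_replicate_le.1 hc)
    have hE : ∀ e ∈ E, e ∈ G.edgeSet := fun e he => hD.1 e (Multiset.mem_add.2 (Or.inr he))
    have hz := h.countP_eq_zero hE
    have hE3 : E.count s(a', b') = 0 := Multiset.count_eq_zero_of_notMem fun h' => n3 (hE _ h')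
    simp only [add_tsub_cancel_left]
    refine ⟨⟨?_, ?_⟩, ?_⟩
    · intro e he
      simp only [Multiset.mem_add] at he
      rw [h.mem_edgeSet]
      rcases he with he | (he | he) | he
      · exact Or.inl (hE e he)
      · exact Or.inr (Or.inl (Multiset.eq_of_mem_replicate he))
      · exact Or.inr (Or.inr (Or.inl (Multiset.eq_of_mem_replicate he)))
      · exact Or.inr (Or.inr (Or.inr (Multiset.eq_of_mem_replicate he)))
    · intro v hv
      simp only [Multiset.countP_add, Multiset.countP_replicate_eq, Sym2.mem_iff]
      rcases (h.mem_support v).1 hv with hv | rfl | rfl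
      · have hva : v ≠ a' := fun h' => h.left_notMem (h' ▸ hv)
        have hvb : v ≠ b' := fun h' => h.right_notMem (h' ▸ hv)
        have := hD.2 v hv
        simp only [Multiset.countP_add, Multiset.countP_replicate_eq, Sym2.mem_iff] at this
        simp only [hva, hvb, or_false, if_false, add_zero]
        -- At `a` and at `b` the `x` removed copies of `ab` are replaced by `x` copies of one new
        -- side, so degrees are kept.
        by_cases hv1 : v = a
        · subst hv1
          simp only [h1, true_or, if_true, if_false] at this ⊢
          omega
        · simp only [hv1, false_or, if_false, zero_add] at this ⊢
          omega
      · simp [hz, h2.symm, h4.symm, h6, hx]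
      · simp [hz, h3.symm, h5.symm, h6.symm, hx]
    · simp [Multiset.count_replicate, hE3, e2, e3]
  · rintro D ⟨-, hD⟩ E ⟨-, hE⟩ hDE
    have := add_right_cancel hDE
    rw [← Multiset.sub_add_cancel (Multiset.le_count_iff_replicate_le.1 hD), this,
      Multiset.sub_add_cancel (Multiset.le_count_iff_replicate_le.1 hE)]
  · rintro D ⟨hD, hc⟩
    obtain ⟨c1, c2⟩ := h.count_add_count hD
    have hd := h.eq_filter_add hD.1
    have hf : ∀ e ∈ D.filter (· ∈ G.edgeSet), e ∈ G.edgeSet := fun e he =>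
      (Multiset.mem_filter.1 he).2
    have k1 : D.count s(a, a') = x := by omega
    have k2 : D.count s(b, b') = x := by omega
    rw [k1, k2, hc] at hd
    -- The preimage restores `x` copies of `ab` in place of the new sides.
    refine ⟨D.filter (· ∈ G.edgeSet) + Multiset.replicate x s(a, b), ⟨⟨?_, ?_⟩, ?_⟩, ?_⟩
    · intro e he
      rcases Multiset.mem_add.1 he with he | he
      · exact hf e he
      · rw [Multiset.eq_of_mem_replicate he]; exact hab
    · intro v hv
      have hva : v ≠ a' := fun h' => h.left_notMem (h' ▸ hv)
      have hvb : v ≠ b' := fun h' => h.right_notMem (h' ▸ hv)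
      have := hD.2 v ((h.mem_support v).2 (Or.inl hv))
      rw [hd] at this
      simp only [Multiset.countP_add, Multiset.countP_replicate_eq, Sym2.mem_iff, hva, hvb,
        or_false, if_false, add_zero] at this ⊢
      by_cases hv1 : v = a
      · subst hv1
        simp only [h1, true_or, if_true, if_false] at this ⊢
        omega
      · simp only [hv1, false_or, if_false, zero_add] at this ⊢
        omega
    · simp
    · simp only [add_tsub_cancel_right]
      exact hd.symm

theorem finite_dimerCovers (h : IsSquareExtension G G' a b a' b') {d : ℕ}
    (hG : (dimerCovers G d).Finite) : (dimerCovers G' d).Finite := by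
  refine ((Set.finite_Iic d).biUnion fun x (hx : x ≤ d) =>
    (h.bijOn hx).finite_iff_finite.1 (hG.subset fun D hD => hD.1)).subset fun D hD => ?_
  have := (h.count_add_count hD).1
  simp only [Set.mem_iUnion, Set.mem_Iic]
  exact ⟨D.count s(a, a'), by omega, hD, by omega⟩

/-- Dimer covers of the extended graph by the multiplicity of the side opposite to the old
graph. -/
theorem ncard_opposite (h : IsSquareExtension G G' a b a' b') {d y : ℕ} (hy : y ≤ d) :
    {D | D ∈ dimerCovers G' d ∧ D.count s(a', b') = y}.ncard =
      {D | D ∈ dimerCovers G d ∧ d - y ≤ D.count s(a, b)}.ncard := by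
  have := (h.bijOn (x := d - y) (Nat.sub_le d y)).ncard_eq
  rw [Nat.sub_sub_self hy] at this
  exact this.symm

/-- Dimer covers of the extended graph by the multiplicity of a side adjacent to the old graph. -/
theorem ncard_adjacent (h : IsSquareExtension G G' a b a' b') {d x : ℕ} (hx : x ≤ d) :
    {D | D ∈ dimerCovers G' d ∧ D.count s(b, b') = x}.ncard =
      {D | D ∈ dimerCovers G d ∧ x ≤ D.count s(a, b)}.ncard := by
  rw [(h.bijOn hx).ncard_eq]
  congr 1
  ext D
  refine and_congr_right fun hD => ?_
  have := (h.count_add_count hD).2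
  omega

end IsSquareExtension

/-! ### Dimer covers of snake graphs -/

theorem mem_edgeSet_snakeGraph (s : List SnakeStep) (e : Sym2 (ℕ × ℕ)) :
    e ∈ (snakeGraph s).edgeSet ↔ ∃ i ≤ s.length,
      e = southSide s i ∨ e = westSide s i ∨ e = northSide s i ∨ e = eastSide s i := by
  rw [snakeGraph, SimpleGraph.edgeSet_fromEdgeSet, Set.mem_sdiff, Set.mem_ofPred_eq,
    and_iff_left_iff_imp]
  rintro ⟨i, -, rfl | rfl | rfl | rfl⟩ <;>
    simp [southSide, westSide, northSide, eastSide, Prod.ext_iff]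

theorem tileCorner_append (s t : List SnakeStep) {i : ℕ} (hi : i ≤ s.length) :
    tileCorner (s ++ t) i = tileCorner s i := by
  rw [tileCorner, tileCorner, List.take_append_of_le_length hi]

theorem tileCorner_mono (s : List SnakeStep) {i j : ℕ} (hij : i ≤ j) :
    tileCorner s i ≤ tileCorner s j :=
  ⟨(List.take_sublist_take_left hij).count_le _, (List.take_sublist_take_left hij).count_le _⟩

/-- No vertex lies beyond the upper right corner of the last tile, so the outer corners of the next
tile are new vertices. -/
theorem le_of_mem_support_snakeGraph {s : List SnakeStep} {v : ℕ × ℕ}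
    (hv : v ∈ (snakeGraph s).support) : v ≤ tileCorner s s.length + (1, 1) := by
  obtain ⟨e, he, hv⟩ := (SimpleGraph.mem_support_iff_exists_mem_edgeSet _ _).1 hv
  obtain ⟨i, hi, he⟩ := (mem_edgeSet_snakeGraph s e).1 he
  have hc := tileCorner_mono s hi
  rw [Prod.le_def] at hc ⊢
  rcases he with rfl | rfl | rfl | rfl <;> rcases Sym2.mem_iff.1 hv with rfl | rfl <;>
    simp only [Prod.fst_add, Prod.snd_add] <;> omega

theorem mem_edgeSet_snakeGraph_concat (s : List SnakeStep) (q : SnakeStep) (e : Sym2 (ℕ × ℕ)) :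
    e ∈ (snakeGraph (s ++ [q])).edgeSet ↔ e ∈ (snakeGraph s).edgeSet ∨
      e = southSide (s ++ [q]) (s.length + 1) ∨ e = westSide (s ++ [q]) (s.length + 1) ∨
      e = northSide (s ++ [q]) (s.length + 1) ∨ e = eastSide (s ++ [q]) (s.length + 1) := by
  rw [mem_edgeSet_snakeGraph, mem_edgeSet_snakeGraph, List.length_append, List.length_singleton]
  constructor
  · rintro ⟨i, hi, he⟩
    rcases Nat.le_succ_iff.1 hi with hi | rfl
    · left
      refine ⟨i, hi, ?_⟩
      simpa only [southSide, westSide, northSide, eastSide, tileCorner_append s [q] hi] using he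
    · exact Or.inr he
  · rintro (⟨i, hi, he⟩ | he)
    · refine ⟨i, by omega, ?_⟩
      simpa only [southSide, westSide, northSide, eastSide, tileCorner_append s [q] hi] using he
    · exact ⟨_, le_rfl, he⟩

theorem tileCorner_concat (s : List SnakeStep) (q : SnakeStep) :
    tileCorner (s ++ [q]) (s.length + 1) = tileCorner s s.length +
      match q with
      | SnakeStep.right => (1, 0)
      | SnakeStep.up => (0, 1) := by
  have := tileCorner_succ (s ++ [q]) ⟨s.length, by simp⟩
  rw [tileCorner_append s [q] le_rfl] at this
  rw [this]
  cases q <;> simp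

theorem isSquareExtension_right (s : List SnakeStep) :
    IsSquareExtension (snakeGraph s) (snakeGraph (s ++ [SnakeStep.right]))
      (tileCorner s s.length + (1, 0)) (tileCorner s s.length + (1, 1))
      (tileCorner s s.length + (2, 0)) (tileCorner s s.length + (2, 1)) where
  adj := (mem_edgeSet_snakeGraph s (eastSide s s.length)).2 ⟨s.length, le_rfl, by simp⟩
  left_notMem h := by
    have := (le_of_mem_support_snakeGraph h).1
    simp at this
  right_notMem h := by
    have := (le_of_mem_support_snakeGraph h).1
    simp at this
  ne := by simp [Prod.ext_iff]
  mem_edgeSet e := by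
    have hE : s(tileCorner s s.length + (1, 0), tileCorner s s.length + (1, 1)) ∈
        (snakeGraph s).edgeSet :=
      (mem_edgeSet_snakeGraph s _).2 ⟨s.length, le_rfl, by simp [eastSide]⟩
    rw [mem_edgeSet_snakeGraph_concat]
    simp only [southSide, westSide, northSide, eastSide, tileCorner_concat, add_assoc,
      Prod.mk_add_mk, Nat.reduceAdd]
    constructor
    -- The case `rfl` is the West side of the new tile: it is the glued edge, already present by
    -- `hE`.
    · rintro (h | h | rfl | h | h) <;> simp [*]
    · rintro (h | h | h | h) <;> simp [*]

theorem isSquareExtension_up (s : List SnakeStep) :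
    IsSquareExtension (snakeGraph s) (snakeGraph (s ++ [SnakeStep.up]))
      (tileCorner s s.length + (0, 1)) (tileCorner s s.length + (1, 1))
      (tileCorner s s.length + (0, 2)) (tileCorner s s.length + (1, 2)) where
  adj := (mem_edgeSet_snakeGraph s (northSide s s.length)).2 ⟨s.length, le_rfl, by simp⟩
  left_notMem h := by
    have := (le_of_mem_support_snakeGraph h).2
    simp at this
  right_notMem h := by
    have := (le_of_mem_support_snakeGraph h).2
    simp at this
  ne := by simp [Prod.ext_iff]
  mem_edgeSet e := by
    have hE : s(tileCorner s s.length + (0, 1), tileCorner s s.length + (1, 1)) ∈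
        (snakeGraph s).edgeSet :=
      (mem_edgeSet_snakeGraph s _).2 ⟨s.length, le_rfl, by simp [northSide]⟩
    rw [mem_edgeSet_snakeGraph_concat]
    simp only [southSide, westSide, northSide, eastSide, tileCorner_concat, add_assoc,
      Prod.mk_add_mk, Nat.reduceAdd]
    constructor
    · rintro (h | rfl | h | h | h) <;> simp [*]
    · rintro (h | h | h | h) <;> simp [*]

/-- The graph with a single edge, the west side of the first tile. -/
def firstEdgeGraph : SimpleGraph (ℕ × ℕ) :=
  SimpleGraph.fromEdgeSet {s((0, 0), (0, 1))}

theorem mem_edgeSet_firstEdgeGraph (e : Sym2 (ℕ × ℕ)) :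
    e ∈ firstEdgeGraph.edgeSet ↔ e = s((0, 0), (0, 1)) := by
  rw [firstEdgeGraph, SimpleGraph.edgeSet_fromEdgeSet, Set.mem_sdiff, Set.mem_singleton_iff,
    and_iff_left_iff_imp]
  rintro rfl
  simp

theorem dimerCovers_firstEdgeGraph (d : ℕ) :
    dimerCovers firstEdgeGraph d = {Multiset.replicate d s((0, 0), (0, 1))} := by
  ext D
  simp only [dimerCovers, mem_edgeSet_firstEdgeGraph, Set.mem_ofPred_eq, Set.mem_singleton_iff]
  constructor
  · rintro ⟨h1, h2⟩
    refine Multiset.eq_replicate.2 ⟨?_, h1⟩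
    rw [← h2 (0, 0) ((SimpleGraph.mem_support_iff_exists_mem_edgeSet _ _).2
      ⟨_, (mem_edgeSet_firstEdgeGraph _).2 rfl, by simp⟩), eq_comm, Multiset.countP_eq_card]
    intro e he
    simp [h1 e he]
  · rintro rfl
    refine ⟨fun e he => Multiset.eq_of_mem_replicate he, fun v hv => ?_⟩
    obtain ⟨e, he, hv⟩ := (SimpleGraph.mem_support_iff_exists_mem_edgeSet _ _).1 hv
    rw [Multiset.countP_replicate_eq, if_pos ((mem_edgeSet_firstEdgeGraph e).1 he ▸ hv)]

/-- Treats the first tile as glued to its own West edge, so that the gluing results also give the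
base case. -/
theorem isSquareExtension_firstEdgeGraph :
    IsSquareExtension firstEdgeGraph (snakeGraph []) (0, 0) (0, 1) (1, 0) (1, 1) where
  adj := (mem_edgeSet_firstEdgeGraph _).2 rfl
  left_notMem h := by
    obtain ⟨e, he, hv⟩ := (SimpleGraph.mem_support_iff_exists_mem_edgeSet _ _).1 h
    rw [mem_edgeSet_firstEdgeGraph] at he
    simp [he] at hv
  right_notMem h := by
    obtain ⟨e, he, hv⟩ := (SimpleGraph.mem_support_iff_exists_mem_edgeSet _ _).1 h
    rw [mem_edgeSet_firstEdgeGraph] at he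
    simp [he] at hv
  ne := by simp
  mem_edgeSet e := by
    rw [mem_edgeSet_firstEdgeGraph, mem_edgeSet_snakeGraph]
    simp [southSide, westSide, northSide, eastSide, tileCorner]
    tauto

theorem finite_dimerCovers_snakeGraph (s : List SnakeStep) (d : ℕ) :
    (dimerCovers (snakeGraph s) d).Finite := by
  induction s using List.reverseRecOn with
  | nil =>
    refine isSquareExtension_firstEdgeGraph.finite_dimerCovers ?_
    rw [dimerCovers_firstEdgeGraph]
    exact Set.finite_singleton _
  | append_singleton s q ih =>
    cases q with
    | right => exact (isSquareExtension_right s).finite_dimerCovers ih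
    | up => exact (isSquareExtension_up s).finite_dimerCovers ih

/-! ### Tile labels and transfer matrices -/

/-- The side of the last tile whose multiplicity is the label of that tile: the North side for
tiles at even distance from the first one, the East side otherwise. -/
def labelSide (s : List SnakeStep) : Sym2 (ℕ × ℕ) :=
  if s.length.bodd then eastSide s s.length else northSide s s.length

/-- The upper right corner of the last tile lies on no other edge. -/
theorem count_north_add_count_east (s : List SnakeStep) {d : ℕ} {D : Multiset (Sym2 (ℕ × ℕ))}
    (hD : D ∈ dimerCovers (snakeGraph s) d) :
    D.count (northSide s s.length) + D.count (eastSide s s.length) = d := by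
  induction s using List.reverseRecOn with
  | nil => exact (isSquareExtension_firstEdgeGraph.count_add_count hD).2
  | append_singleton s q =>
    rw [List.length_append, List.length_singleton]
    cases q with
    | right =>
      have := ((isSquareExtension_right s).count_add_count hD).2
      simpa [northSide, eastSide, tileCorner_concat, add_assoc] using this
    | up =>
      have := ((isSquareExtension_up s).count_add_count hD).2
      rw [add_comm]
      simpa [northSide, eastSide, tileCorner_concat, add_assoc] using this

theorem ncard_eq_sum_ncard_fiber {α : Type*} {A : Set α} (hA : A.Finite) (d : ℕ) (c : α → ℕ)
    (hc : ∀ D ∈ A, c D ≤ d) (p : ℕ → Prop) [DecidablePred p] :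
    {D | D ∈ A ∧ p (c D)}.ncard =
      ∑ j ∈ Finset.univ.filter (fun j : Fin (d + 1) => p j), {D | D ∈ A ∧ c D = j}.ncard := by
  classical
  have hf : ∀ (q : α → Prop) [DecidablePred q], {D | D ∈ A ∧ q D}.ncard = (hA.toFinset.filter q).card := fun q _ => by
    rw [← Set.ncard_coe_finset]
    congr 1
    ext D
    simp
  simp only [hf]
  -- `Fin.ofNat` reduces modulo `d + 1`, which changes nothing because `c` is at most `d` on `A`.
  rw [Finset.card_eq_sum_card_fiberwise (f := fun D => Fin.ofNat (d + 1) (c D))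
    (t := Finset.univ.filter fun j : Fin (d + 1) => p j)]
  · refine Finset.sum_congr rfl fun j hj => ?_
    congr 1
    ext D
    have hj' := (Finset.mem_filter.1 hj).2
    simp only [Finset.mem_filter, Set.Finite.mem_toFinset, Fin.ext_iff, Fin.val_ofNat]
    constructor
    · rintro ⟨⟨h1, h2⟩, h3⟩
      rw [Nat.mod_eq_of_lt (by have := hc D h1; omega)] at h3
      exact ⟨h1, h3⟩
    · rintro ⟨h1, h2⟩
      rw [h2, Nat.mod_eq_of_lt j.isLt]
      exact ⟨⟨h1, hj'⟩, rfl⟩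
  · intro D hD
    obtain ⟨h1, h2⟩ := Finset.mem_filter.1 (Finset.mem_coe.1 hD)
    have := hc D (hA.mem_toFinset.1 h1)
    simpa [Nat.mod_eq_of_lt (show c D < d + 1 by omega)] using h2

theorem transferMatrix_vecMul (d : ℕ) (b : Bool) (v : Fin (d + 1) → ℕ) (j : Fin (d + 1)) :
    (Matrix.vecMul v (transferMatrix d b)) j =
      ∑ i : Fin (d + 1) with (if b then i ≤ j else j ≤ i), v i := by
  simp only [Matrix.vecMul, dotProduct, transferMatrix, Matrix.of_apply, mul_ite, mul_one,
    mul_zero, Finset.sum_filter]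

theorem count_labelSide_le (s : List SnakeStep) {d : ℕ} {D : Multiset (Sym2 (ℕ × ℕ))}
    (hD : D ∈ dimerCovers (snakeGraph s) d) : D.count (labelSide s) ≤ d := by
  have := count_north_add_count_east s hD
  rw [labelSide]
  split_ifs <;> omega

/-- Adding a tile multiplies the vector counting dimer covers by the label of the last tile with
a transfer matrix. -/
theorem ncard_labelSide_concat (s : List SnakeStep) (q : SnakeStep) (d : ℕ) (j : Fin (d + 1)) :
    {D | D ∈ dimerCovers (snakeGraph (s ++ [q])) d ∧ D.count (labelSide (s ++ [q])) = j}.ncard =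
      {D | D ∈ dimerCovers (snakeGraph s) d ∧
        if decide (q = SnakeStep.right) ^^ s.length.bodd then D.count (labelSide s) ≤ j
        else j ≤ D.count (labelSide s)}.ncard := by
  have hj := j.is_le
  cases q with
  | right =>
    have hE : eastSide (s ++ [SnakeStep.right]) (s.length + 1) =
        s(tileCorner s s.length + (2, 0), tileCorner s s.length + (2, 1)) := by
      simp [eastSide, tileCorner_concat, add_assoc]
    have hN : northSide (s ++ [SnakeStep.right]) (s.length + 1) =
        s(tileCorner s s.length + (1, 1), tileCorner s s.length + (2, 1)) := by
      simp [northSide, tileCorner_concat, add_assoc]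
    rw [labelSide, List.length_append, List.length_singleton, Nat.bodd_succ, hE, hN]
    -- In the even case the new label side is opposite to the glued East edge, whose multiplicity is
    -- `d` minus the old label: the bound turns into old label ≤ `j`. In the odd case the glued edge
    -- carries the old label and the new label side is adjacent to it: `j` ≤ old label. For a step
    -- up the parities swap roles.
    cases hs : s.length.bodd
    · refine ((isSquareExtension_right s).ncard_opposite hj).trans ?_
      congr 1
      ext D
      refine and_congr_right fun hD => ?_
      have := count_north_add_count_east s hD
      rw [eastSide] at this
      simp only [labelSide, hs, decide_true, Bool.xor_false, if_true]
      simp only [Bool.false_eq_true, if_false]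
      omega
    · refine ((isSquareExtension_right s).ncard_adjacent hj).trans ?_
      congr 1
      ext D
      refine and_congr_right fun hD => ?_
      simp [labelSide, hs, eastSide]
  | up =>
    have hN : northSide (s ++ [SnakeStep.up]) (s.length + 1) =
        s(tileCorner s s.length + (0, 2), tileCorner s s.length + (1, 2)) := by
      simp [northSide, tileCorner_concat, add_assoc]
    have hE : eastSide (s ++ [SnakeStep.up]) (s.length + 1) =
        s(tileCorner s s.length + (1, 1), tileCorner s s.length + (1, 2)) := by
      simp [eastSide, tileCorner_concat, add_assoc]
    rw [labelSide, List.length_append, List.length_singleton, Nat.bodd_succ, hE, hN]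
    cases hs : s.length.bodd
    · refine ((isSquareExtension_up s).ncard_adjacent hj).trans ?_
      congr 1
      ext D
      refine and_congr_right fun hD => ?_
      simp [labelSide, hs, northSide]
    · refine ((isSquareExtension_up s).ncard_opposite hj).trans ?_
      congr 1
      ext D
      refine and_congr_right fun hD => ?_
      have := count_north_add_count_east s hD
      rw [northSide] at this
      simp only [labelSide, hs, if_true, reduceCtorEq, decide_false, Bool.false_xor]
      omega

theorem ncard_labelSide (s : List SnakeStep) (d : ℕ) (j : Fin (d + 1)) :
    {D | D ∈ dimerCovers (snakeGraph s) d ∧ D.count (labelSide s) = j}.ncard =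
      Matrix.vecMul 1 (transferProd d (abstractString s)) j := by
  induction s using List.reverseRecOn generalizing j with
  | nil =>
    refine (isSquareExtension_firstEdgeGraph.ncard_adjacent j.is_le).trans ?_
    -- The only cover of a single edge takes it `d` times, so every label of the first tile occurs
    -- exactly once: the all-ones row vector.
    have : {D | D ∈ dimerCovers firstEdgeGraph d ∧
        (j : ℕ) ≤ D.count s(((0, 0) : ℕ × ℕ), (0, 1))} =
          {Multiset.replicate d s((0, 0), (0, 1))} := by
      rw [dimerCovers_firstEdgeGraph]
      ext D
      simp only [Set.mem_singleton_iff, Set.mem_ofPred_eq, and_iff_left_iff_imp]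
      rintro rfl
      rw [Multiset.count_replicate_self]
      exact j.is_le
    rw [this, Set.ncard_singleton, abstractString, transferProd_nil, Matrix.vecMul_one]
    rfl
  | append_singleton s q ih =>
    rw [abstractString_concat, transferProd_append, ← Matrix.vecMul_vecMul, transferProd_cons,
      transferProd_nil, mul_one, transferMatrix_vecMul, ncard_labelSide_concat,
      ncard_eq_sum_ncard_fiber (finite_dimerCovers_snakeGraph s d) d
        (fun D => D.count (labelSide s)) (fun D hD => count_labelSide_le s hD)
        (fun i => if decide (q = SnakeStep.right) ^^ s.length.bodd then i ≤ j else j ≤ i)]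
    simp only [ih]
    rfl

/-- The number of dimer covers of a snake graph is given by the transfer matrices of its abstract
string. -/
theorem ncard_dimerCovers_snakeGraph (s : List SnakeStep) (d : ℕ) :
    (dimerCovers (snakeGraph s) d).ncard = transferCount d (abstractString s) := by
  have h := ncard_eq_sum_ncard_fiber (finite_dimerCovers_snakeGraph s d) d
    (fun D => D.count (labelSide s)) (fun D hD => count_labelSide_le s hD) fun _ => True
  simp only [and_true, Finset.filter_true, ncard_labelSide, Set.ofPred_mem_eq] at h
  rw [h, transferCount]
  simp only [Matrix.vecMul, Matrix.mulVec, dotProduct, Pi.one_apply, one_mul, mul_one]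
  exact Finset.sum_comm

/-! ### Truncated polynomials -/

namespace TruncPoly

variable {K : Type*} [Field K] {d : ℕ}

/-- The preimage in K[X] is principal and contains X^d, so its generator is associated to a power of
the prime X. -/
theorem ideal_eq_span_eps_pow (J : Ideal (TruncPoly K d)) :
    ∃ k ≤ d, J = Ideal.span {eps K d ^ k} := by
  obtain ⟨g, hg⟩ := IsPrincipalIdealRing.principal
    (J.comap (Ideal.Quotient.mk (Ideal.span {(Polynomial.X : Polynomial K) ^ d})))
  have hX : (Polynomial.X : Polynomial K) ^ d ∈
      J.comap (Ideal.Quotient.mk (Ideal.span {(Polynomial.X : Polynomial K) ^ d})) := by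
    rw [Ideal.mem_comap, Ideal.Quotient.eq_zero_iff_mem.2 (Ideal.mem_span_singleton_self _)]
    exact J.zero_mem
  rw [hg] at hX
  obtain ⟨k, hk, hgk⟩ := (dvd_prime_pow Polynomial.prime_X d).1 (Ideal.mem_span_singleton.1 hX)
  refine ⟨k, hk, ?_⟩
  rw [← Ideal.map_comap_of_surjective _ Ideal.Quotient.mk_surjective J, hg]
  change Ideal.map _ (Ideal.span {g}) = _
  rw [Ideal.span_singleton_eq_span_singleton.2 hgk, Ideal.map_span, Set.image_singleton, map_pow]
  rfl

/-- The bound `k < d` excludes ε^d = 0, which lies in every ideal. -/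
theorem le_of_eps_pow_mem {k l : ℕ} (hk : k < d) (h : eps K d ^ k ∈ Ideal.span {eps K d ^ l}) :
    l ≤ k := by
  obtain ⟨q, hq⟩ := Ideal.mem_span_singleton'.1 h
  obtain ⟨q, rfl⟩ := Ideal.Quotient.mk_surjective q
  rw [eps, ← map_pow, ← map_pow, ← map_mul, Ideal.Quotient.eq, Ideal.mem_span_singleton] at hq
  by_contra! hl
  have h1 : (Polynomial.X : Polynomial K) ^ (k + 1) ∣ Polynomial.X ^ k := by
    have h2 := (pow_dvd_pow (Polynomial.X : Polynomial K) hk).trans hq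
    exact (dvd_sub_right ((pow_dvd_pow _ hl).mul_left q)).1 h2
  have := Polynomial.X_pow_dvd_iff.1 h1 k (Nat.lt_succ_self k)
  simp at this

theorem eps_pow_mem {k l : ℕ} (h : k ≤ l) : eps K d ^ l ∈ Ideal.span {eps K d ^ k} :=
  Ideal.mem_span_singleton.2 (pow_dvd_pow _ h)

theorem smul_mem (J : Ideal (TruncPoly K d)) (c : K) {p : TruncPoly K d} (hp : p ∈ J) :
    c • p ∈ J :=
  Submodule.smul_of_tower_mem J c hp

@[elab_as_elim]
theorem induction {motive : TruncPoly K d → Prop} (q : TruncPoly K d)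
    (add : ∀ p q, motive p → motive q → motive (p + q))
    (smul_eps_pow : ∀ (c : K) (k : ℕ), motive (c • eps K d ^ k)) : motive q := by
  obtain ⟨q, rfl⟩ := Ideal.Quotient.mk_surjective q
  induction q using Polynomial.induction_on' with
  | add p q hp hq => rw [map_add]; exact add _ _ hp hq
  | monomial n a =>
    convert smul_eps_pow a n using 1
    rw [← Polynomial.C_mul_X_pow_eq_monomial, ← Polynomial.smul_eq_C_mul, eps, ← map_pow]
    rfl

end TruncPoly

/-! ### Coordinates of induced modules -/

namespace InducedModule

variable {K : Type*} [Field K] {Λ : Type*} [Ring Λ] [Algebra K Λ] {M : Type*}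
    [AddCommGroup M] [Module K M] [Module Λ M] [IsScalarTower K Λ M] {d : ℕ}

instance : IsScalarTower K (Λ ⊗[K] TruncPoly K d) (InducedModule K Λ M d) where
  smul_assoc c r m := by
    change action K Λ M d (c • r) m = c • action K Λ M d r m
    rw [map_smul, LinearMap.smul_apply]

/-- The induced module as a tensor product. -/
noncomputable def equivTensor : InducedModule K Λ M d ≃ₗ[K] M ⊗[K] TruncPoly K d :=
  LinearEquiv.refl K (M ⊗[K] TruncPoly K d)

/-- The pure tensors as a bilinear map. -/
noncomputable def mkHom : M →ₗ[K] TruncPoly K d →ₗ[K] InducedModule K Λ M d :=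
  TensorProduct.mk K M (TruncPoly K d)

theorem mkHom_apply (m : M) (p : TruncPoly K d) :
    mkHom (Λ := Λ) m p = tmul K Λ M d m p := rfl

@[elab_as_elim]
theorem induction {motive : InducedModule K Λ M d → Prop} (x : InducedModule K Λ M d)
    (zero : motive 0) (tmul : ∀ m p, motive (tmul K Λ M d m p))
    (add : ∀ x y, motive x → motive y → motive (x + y)) : motive x :=
  TensorProduct.induction_on (motive := motive) x zero tmul add

theorem smul_induction {motive : InducedModule K Λ M d → Prop} (m : InducedModule K Λ M d)
    (zero : motive 0) (tmul : ∀ (x : Λ) (q : TruncPoly K d),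
      motive ((x ⊗ₜ[K] q : Λ ⊗[K] TruncPoly K d) • m))
    (add : ∀ x y, motive x → motive y → motive (x + y)) (r : Λ ⊗[K] TruncPoly K d) :
    motive (r • m) := by
  induction r using TensorProduct.induction_on with
  | zero => exact (congrArg motive (LinearMap.congr_fun (map_zero (action K Λ M d)) m)).mpr zero
  | tmul x q => exact tmul x q
  | add r r' hr hr' =>
    exact (congrArg motive (LinearMap.congr_fun (map_add (action K Λ M d) r r') m)).mpr
      (add _ _ hr hr')

end InducedModule

/-! ### Matrix entries of the path algebra action -/

namespace QuiverString

variable {K : Type*} [Field K] {V : Type*} [Quiver V] {u : List Bool} (w : QuiverString V u)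

/-- Two distinct letters with a common tail position are neighbours pointing away from each other;
were they the same arrow, the walk would not be reduced. -/
theorem eq_of_tailIndex_eq {i j : Fin u.length} (h : w.letter i = w.letter j)
    (ht : tailIndex u i = tailIndex u j) : i = j := by
  have h1 := w.reduced i j
  have h2 := w.reduced j i
  simp only [tailIndex] at ht
  by_contra hij
  have hij' : (i : ℕ) ≠ j := fun h => hij (Fin.ext h)
  split_ifs at ht with hi hj hj <;> simp only [Fin.ext_iff, Fin.val_castSucc, Fin.val_succ] at ht
  · exact hij' ht
  · exact h2 ht (fun h' => hj (h' ▸ hi)) h.symm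
  · exact h1 ht.symm (fun h' => hi (h' ▸ hj)) h
  · omega

/-- Reducedness guarantees that no other occurrence of the same arrow starts at this position, so a
single basis vector appears. -/
theorem arrowMap_letter_single (i : Fin u.length) :
    w.arrowMap K (w.letter i) (Pi.single (tailIndex u i) 1) = Pi.single (headIndex u i) 1 := by
  classical
  funext j
  rw [arrowMap_apply, Finset.sum_eq_single i]
  · by_cases h : headIndex u i = j
    · subst h; simp
    · simp [h, Ne.symm h]
  · intro k _ hk
    split_ifs with h
    · rw [Pi.single_apply, if_neg fun h' => hk (w.eq_of_tailIndex_eq h.1 h')]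
    · rfl
  · simp

theorem vertexMap_of_injective (hw : Function.Injective w.vertex) (i : Fin (u.length + 1))
    (x : Fin (u.length + 1) → K) :
    w.vertexMap K (w.vertex i) x = Pi.single i (x i) := by
  funext j
  rw [vertexMap_apply, Pi.single_apply]
  by_cases h : j = i
  · subst h; simp
  · rw [if_neg fun h' => h (hw h'), if_neg h]

variable [Fintype V]

theorem pathAction_vertex (v : V) :
    w.pathAction K (RingQuot.mkAlgHom K (PathRel K V) (FreeAlgebra.ι K (Sum.inl v))) =
      w.vertexMap K v := by
  rw [pathAction, RingQuot.liftAlgHom_mkAlgHom_apply, FreeAlgebra.lift_ι_apply, Sum.elim_inl]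

theorem pathAction_arrow (a : Quiver.Total V) :
    w.pathAction K (RingQuot.mkAlgHom K (PathRel K V) (FreeAlgebra.ι K (Sum.inr a))) =
      w.arrowMap K a := by
  rw [pathAction, RingQuot.liftAlgHom_mkAlgHom_apply, FreeAlgebra.lift_ι_apply, Sum.elim_inr]

/-- The matrix entries of the path algebra on a string representation respect every labeling that
increases weakly along the arrows. -/
theorem le_of_pathAction_single_ne_zero {d : ℕ} {h : Fin (u.length + 1) → Fin (d + 1)}
    (hh : h ∈ monotoneLabelings d u) (x : PathAlgebra K V) (i j : Fin (u.length + 1))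
    (hx : w.pathAction K x (Pi.single i 1) j ≠ 0) : h i ≤ h j := by
  classical
  obtain ⟨x, rfl⟩ := RingQuot.mkAlgHom_surjective K (PathRel K V) x
  induction x using FreeAlgebra.induction generalizing i j with
  | grade0 c =>
    by_cases hij : i = j
    · rw [hij]
    · simp [Algebra.algebraMap_eq_smul_one, Ne.symm hij] at hx
  | grade1 g =>
    cases g with
    | inl v =>
      rw [pathAction_vertex, vertexMap_apply] at hx
      by_cases hij : i = j
      · rw [hij]
      · simp [Ne.symm hij] at hx
    | inr a =>
      rw [pathAction_arrow, arrowMap_apply] at hx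
      obtain ⟨k, -, hk⟩ := Finset.exists_ne_zero_of_sum_ne_zero hx
      obtain ⟨⟨-, rfl⟩, hk'⟩ := ite_ne_right_iff.1 hk
      have : tailIndex u k = i := by
        by_contra hne
        exact hk' (Pi.single_eq_of_ne hne _)
      exact this ▸ hh k
  | mul a b ha hb =>
    rw [map_mul, map_mul, Module.End.mul_apply] at hx
    obtain ⟨y, hy⟩ : ∃ y, w.pathAction K (RingQuot.mkAlgHom K (PathRel K V) b)
      (Pi.single i 1) = y := ⟨_, rfl⟩
    -- A nonzero entry of a product passes through some intermediate basis vector `k`, and the two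
    -- inequalities compose.
    have hy' : y = ∑ k, y k • Pi.single k (1 : K) := by
      simpa using (pi_eq_sum_univ' y)
    rw [hy, hy', map_sum, Finset.sum_apply] at hx
    obtain ⟨k, -, hk⟩ := Finset.exists_ne_zero_of_sum_ne_zero hx
    rw [map_smul, Pi.smul_apply, smul_eq_mul] at hk
    exact (hb i k (hy ▸ left_ne_zero_of_mul hk)).trans (ha k j (right_ne_zero_of_mul hk))
  | add a b ha hb =>
    rw [map_add, map_add, LinearMap.add_apply, Pi.add_apply] at hx
    by_cases h0 : w.pathAction K (RingQuot.mkAlgHom K (PathRel K V) a) (Pi.single i 1) j = 0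
    · exact hb i j (by rwa [h0, zero_add] at hx)
    · exact ha i j h0

end QuiverString

/-! ### Arrows and idempotents on the standard basis -/

namespace StringModule

variable {K : Type*} [Field K] {V : Type*} [Quiver V] [Fintype V] {u : List Bool}
  (w : QuiverString V u) (I : Ideal (PathAlgebra K V)) (hI : w.IsAnnihilatedBy K I)

/-- A string module as a space of functions on the vertices of the string. -/
def equivFun : StringModule w I hI ≃ₗ[K] (Fin (u.length + 1) → K) :=
  LinearEquiv.refl K (Fin (u.length + 1) → K)

theorem equivFun_basisVec (i : Fin (u.length + 1)) :
    equivFun w I hI (basisVec w I hI i) = Pi.single i 1 := rfl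

theorem sum_smul_basisVec (m : StringModule w I hI) :
    ∑ i, equivFun w I hI m i • basisVec w I hI i = m := by
  apply (equivFun w I hI).injective
  rw [map_sum]
  simp only [map_smul, equivFun_basisVec]
  exact (pi_eq_sum_univ' _).symm

variable [I.IsTwoSided]

theorem equivFun_mk_smul (x : PathAlgebra K V) (m : StringModule w I hI) :
    equivFun w I hI ((Ideal.Quotient.mk I x) • m) = w.pathAction K x (equivFun w I hI m) := rfl

theorem arrow_smul_basisVec (i : Fin u.length) :
    (Ideal.Quotient.mk I
      (RingQuot.mkAlgHom K (PathRel K V) (FreeAlgebra.ι K (Sum.inr (w.letter i))))) •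
        basisVec w I hI (tailIndex u i) = basisVec w I hI (headIndex u i) := by
  apply (equivFun w I hI).injective
  rw [equivFun_mk_smul, w.pathAction_arrow, equivFun_basisVec, equivFun_basisVec,
    w.arrowMap_letter_single]

theorem vertex_smul (hw : Function.Injective w.vertex) (i : Fin (u.length + 1))
    (m : StringModule w I hI) :
    (Ideal.Quotient.mk I
      (RingQuot.mkAlgHom K (PathRel K V) (FreeAlgebra.ι K (Sum.inl (w.vertex i))))) • m =
        equivFun w I hI m i • basisVec w I hI i := by
  apply (equivFun w I hI).injective
  rw [equivFun_mk_smul, w.pathAction_vertex, map_smul, equivFun_basisVec,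
    w.vertexMap_of_injective hw]
  funext j
  simp [Pi.single_apply]

end StringModule

/-! ### Canonical submodules -/

namespace InducedStringModule

open InducedModule StringModule

variable {K : Type*} [Field K] {V : Type*} [Quiver V] [Fintype V] {u : List Bool}
  (w : QuiverString V u) (I : Ideal (PathAlgebra K V)) [I.IsTwoSided]
  (hI : w.IsAnnihilatedBy K I) (d : ℕ)

/-- The tensor of a standard basis vector of the string module with a truncated polynomial. -/
noncomputable def single (i : Fin (u.length + 1)) :
    TruncPoly K d →ₗ[K] InducedStringModule w I hI d :=
  mkHom (basisVec w I hI i)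

theorem single_apply (i : Fin (u.length + 1)) (p : TruncPoly K d) :
    single w I hI d i p =
      tmul K (PathAlgebra K V ⧸ I) (StringModule w I hI) d (basisVec w I hI i) p := rfl

/-- The coordinates of the induced module with respect to the standard basis of the string
module. -/
noncomputable def coord (i : Fin (u.length + 1)) :
    InducedStringModule w I hI d →ₗ[K] TruncPoly K d :=
  (TensorProduct.lift (LinearMap.lsmul K (TruncPoly K d) ∘ₗ
    LinearMap.proj i ∘ₗ (equivFun w I hI).toLinearMap)) ∘ₗ equivTensor.toLinearMap

theorem coord_tmul (i : Fin (u.length + 1)) (m : StringModule w I hI) (p : TruncPoly K d) :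
    coord w I hI d i (tmul K (PathAlgebra K V ⧸ I) (StringModule w I hI) d m p) =
      equivFun w I hI m i • p := rfl

theorem coord_single (i j : Fin (u.length + 1)) (p : TruncPoly K d) :
    coord w I hI d j (single w I hI d i p) = if j = i then p else 0 := by
  rw [single_apply, coord_tmul, equivFun_basisVec, Pi.single_apply, ite_smul, one_smul, zero_smul]

theorem sum_single_coord (m : InducedStringModule w I hI d) :
    ∑ i, single w I hI d i (coord w I hI d i m) = m := by
  induction m using InducedModule.induction with
  | zero => simp
  | tmul m p =>
    conv_rhs => rw [← sum_smul_basisVec w I hI m, ← mkHom_apply, map_sum, LinearMap.sum_apply]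
    refine Finset.sum_congr rfl fun i _ => ?_
    rw [coord_tmul, map_smul, map_smul, LinearMap.smul_apply]
    rfl
  | add x y hx hy =>
    simp only [map_add, Finset.sum_add_distrib, hx, hy]

theorem tmul_smul_single (x : PathAlgebra K V ⧸ I) (q p : TruncPoly K d)
    (i : Fin (u.length + 1)) :
    (x ⊗ₜ[K] q : (PathAlgebra K V ⧸ I) ⊗[K] TruncPoly K d) • single w I hI d i p =
      tmul K (PathAlgebra K V ⧸ I) (StringModule w I hI) d (x • basisVec w I hI i) (q * p) := by
  rw [single_apply, smul_tmul]

theorem coord_smul (x : PathAlgebra K V) (q : TruncPoly K d) (m : InducedStringModule w I hI d)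
    (j : Fin (u.length + 1)) :
    coord w I hI d j
      ((Ideal.Quotient.mk I x ⊗ₜ[K] q : (PathAlgebra K V ⧸ I) ⊗[K] TruncPoly K d) • m) =
      ∑ i, w.pathAction K x (Pi.single i 1) j • (q * coord w I hI d i m) := by
  conv_lhs => rw [← sum_single_coord w I hI d m, Finset.smul_sum, map_sum]
  refine Finset.sum_congr rfl fun i _ => ?_
  rw [tmul_smul_single, coord_tmul, equivFun_mk_smul, equivFun_basisVec]

/-! ### Labelings versus canonical submodules -/

/-- The canonical submodule attached to a labeling that increases weakly along the arrows: its
`i`-th component is generated by `ε ^ (d - h i)`. -/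
noncomputable def ofLabeling (h : Fin (u.length + 1) → Fin (d + 1))
    (hh : h ∈ monotoneLabelings d u) : InducedStringSubmodule w I hI d where
  carrier := {m | ∀ i, coord w I hI d i m ∈ Ideal.span {TruncPoly.eps K d ^ (d - (h i : ℕ))}}
  add_mem' hx hy i := by
    rw [map_add]
    exact Ideal.add_mem _ (hx i) (hy i)
  zero_mem' i := by
    rw [map_zero]
    exact Ideal.zero_mem _
  smul_mem' r m hm j := by
    refine InducedModule.smul_induction (motive := fun m =>
      coord w I hI d j m ∈ Ideal.span {TruncPoly.eps K d ^ (d - (h j : ℕ))}) m ?_ ?_ ?_ r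
    · rw [map_zero]
      exact Ideal.zero_mem _
    · intro x q
      obtain ⟨x, rfl⟩ := Ideal.Quotient.mk_surjective x
      rw [coord_smul]
      refine Ideal.sum_mem _ fun i _ => ?_
      by_cases hx : w.pathAction K x (Pi.single i 1) j = 0
      · rw [hx, zero_smul]
        exact Ideal.zero_mem _
      · have hij : (h i : ℕ) ≤ h j := w.le_of_pathAction_single_ne_zero hh x i j hx
        refine TruncPoly.smul_mem _ _ (Ideal.mul_mem_left _ _ ?_)
        exact Ideal.span_singleton_le_span_singleton.2 (pow_dvd_pow _ (by omega)) (hm i)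
    · intro x y hx hy
      rw [map_add]
      exact Ideal.add_mem _ hx hy

theorem mem_ofLabeling {h : Fin (u.length + 1) → Fin (d + 1)} {hh : h ∈ monotoneLabelings d u}
    {m : InducedStringModule w I hI d} : m ∈ ofLabeling w I hI d h hh ↔
      ∀ i, coord w I hI d i m ∈ Ideal.span {TruncPoly.eps K d ^ (d - (h i : ℕ))} := Iff.rfl

theorem single_mem_ofLabeling {h : Fin (u.length + 1) → Fin (d + 1)}
    {hh : h ∈ monotoneLabelings d u} {i : Fin (u.length + 1)} {p : TruncPoly K d} :
    single w I hI d i p ∈ ofLabeling w I hI d h hh ↔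
      p ∈ Ideal.span {TruncPoly.eps K d ^ (d - (h i : ℕ))} := by
  simp only [mem_ofLabeling, coord_single]
  constructor
  · intro h
    simpa using h i
  · intro h j
    split_ifs with hj
    · exact hj ▸ h
    · exact Ideal.zero_mem _

variable {w I hI d}

/-- The ideal of the truncated polynomials `p` with `v_i ⊗ p` in a given submodule. -/
def component (N : InducedStringSubmodule w I hI d) (i : Fin (u.length + 1)) :
    Ideal (TruncPoly K d) where
  carrier := {p | single w I hI d i p ∈ N}
  add_mem' hx hy := by
    rw [Set.mem_ofPred_eq, map_add]
    exact N.add_mem hx hy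
  zero_mem' := by
    rw [Set.mem_ofPred_eq, map_zero]
    exact N.zero_mem
  smul_mem' q p hp := by
    have := N.smul_mem (1 ⊗ₜ[K] q) hp
    rwa [tmul_smul_single, one_smul] at this

theorem mem_component {N : InducedStringSubmodule w I hI d} {i : Fin (u.length + 1)}
    {p : TruncPoly K d} : p ∈ component N i ↔ single w I hI d i p ∈ N := Iff.rfl

theorem component_tailIndex_le (N : InducedStringSubmodule w I hI d) (i : Fin u.length) :
    component N (tailIndex u i) ≤ component N (headIndex u i) := fun p hp => by
  have := N.smul_mem ((Ideal.Quotient.mk I (RingQuot.mkAlgHom K (PathRel K V)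
    (FreeAlgebra.ι K (Sum.inr (w.letter i))))) ⊗ₜ[K] 1) hp
  rwa [tmul_smul_single, arrow_smul_basisVec, one_mul] at this

/-- Canonical means being the direct sum of the components. A span of monomials v_i ⊗ ε^k is closed
under taking coordinates; conversely each component is generated by a power of ε, hence spanned over
K by monomials. -/
theorem mem_canonicalSubmodules_iff (N : InducedStringSubmodule w I hI d) :
    N ∈ canonicalSubmodules w I hI d ↔ ∀ m ∈ N, ∀ i, coord w I hI d i m ∈ component N i := by
  constructor
  · rintro ⟨S, hS⟩ m hm i
    have hm' : m ∈ Submodule.span K ((fun p : Fin (u.length + 1) × ℕ =>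
        tmul K (PathAlgebra K V ⧸ I) (StringModule w I hI) d
        (basisVec w I hI p.1) (TruncPoly.eps K d ^ p.2)) '' S) := by
      rw [← SetLike.mem_coe, ← hS]
      exact hm
    have hle : ∀ x ∈ (fun p : Fin (u.length + 1) × ℕ =>
        tmul K (PathAlgebra K V ⧸ I) (StringModule w I hI) d
        (basisVec w I hI p.1) (TruncPoly.eps K d ^ p.2)) '' S, x ∈ N := fun x hx => by
      rw [← SetLike.mem_coe, hS]
      exact Submodule.subset_span hx
    induction hm' using Submodule.span_induction with
    | mem x hx =>
      have hxN := hle x hx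
      obtain ⟨⟨j, k⟩, -, rfl⟩ := hx
      change coord w I hI d i (single w I hI d j (TruncPoly.eps K d ^ k)) ∈ _
      rw [coord_single]
      split_ifs with hij
      · subst hij
        exact hxN
      · exact Ideal.zero_mem _
    | zero => rw [map_zero]; exact Ideal.zero_mem _
    | add x y hx hy ihx ihy =>
      rw [map_add]
      refine Ideal.add_mem _ (ihx ?_) (ihy ?_)
      all_goals
        rw [← SetLike.mem_coe, hS]
        assumption
    | smul c x hx ih =>
      rw [map_smul]
      refine TruncPoly.smul_mem _ _ (ih ?_)
      rw [← SetLike.mem_coe, hS]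
      exact hx
  · intro h
    -- The spanning set consists of all monomials lying in `N`.
    refine ⟨{p | TruncPoly.eps K d ^ p.2 ∈ component N p.1}, Set.Subset.antisymm ?_ ?_⟩
    · intro m hm
      rw [SetLike.mem_coe, ← sum_single_coord w I hI d m]
      refine Submodule.sum_mem _ fun i _ => ?_
      have hi := h m hm i
      obtain ⟨k, -, hk⟩ := TruncPoly.ideal_eq_span_eps_pow (component N i)
      rw [hk] at hi
      obtain ⟨q, hq⟩ := Ideal.mem_span_singleton'.1 hi
      rw [← hq]
      clear hq
      induction q using TruncPoly.induction with
      | add p q hp hq => rw [add_mul, map_add]; exact Submodule.add_mem _ hp hq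
      | smul_eps_pow c l =>
        rw [smul_mul_assoc, map_smul, ← pow_add]
        refine Submodule.smul_mem _ _ (Submodule.subset_span ⟨(i, l + k), ?_, rfl⟩)
        rw [Set.mem_ofPred_eq, hk]
        exact TruncPoly.eps_pow_mem (Nat.le_add_left k l)
    · have : Submodule.span K ((fun p : Fin (u.length + 1) × ℕ =>
          tmul K (PathAlgebra K V ⧸ I) (StringModule w I hI) d
          (basisVec w I hI p.1) (TruncPoly.eps K d ^ p.2)) ''
            {p | TruncPoly.eps K d ^ p.2 ∈ component N p.1}) ≤ N.restrictScalars K := by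
        rw [Submodule.span_le]
        rintro _ ⟨p, hp, rfl⟩
        exact hp
      exact this

theorem ofLabeling_mem_canonicalSubmodules (h : Fin (u.length + 1) → Fin (d + 1))
    (hh : h ∈ monotoneLabelings d u) :
    ofLabeling w I hI d h hh ∈ canonicalSubmodules w I hI d :=
  (mem_canonicalSubmodules_iff _).2 fun _ hm i => (single_mem_ofLabeling w I hI d (hh := hh)).2 (hm i)

theorem le_of_ofLabeling_eq {h h' : Fin (u.length + 1) → Fin (d + 1)}
    {hh : h ∈ monotoneLabelings d u} {hh' : h' ∈ monotoneLabelings d u}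
    (H : ofLabeling w I hI d h hh = ofLabeling w I hI d h' hh') : h ≤ h' := by
  intro i
  -- A label 0 corresponds to ε^d = 0 and carries no information, but it is below everything;
  -- otherwise the exponent is less than `d` and can be compared.
  by_cases h0 : (h i : ℕ) = 0
  · exact Fin.le_def.2 (h0 ▸ Nat.zero_le _)
  · have h1 : single w I hI d i (TruncPoly.eps K d ^ (d - (h i : ℕ))) ∈
        ofLabeling w I hI d h' hh' :=
      H ▸ (single_mem_ofLabeling w I hI d).2 (Ideal.mem_span_singleton_self _)
    have hi := (h i).is_le
    have h2 := TruncPoly.le_of_eps_pow_mem (by omega)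
      ((single_mem_ofLabeling w I hI d).1 h1)
    have hi' := (h' i).is_le
    rw [Fin.le_def]
    omega

theorem exists_ofLabeling_eq {N : InducedStringSubmodule w I hI d}
    (hN : N ∈ canonicalSubmodules w I hI d) :
    ∃ h hh, ofLabeling w I hI d h hh = N := by
  choose k hk hkN using fun i => TruncPoly.ideal_eq_span_eps_pow (component N i)
  have hdk : ∀ i, d - (d - k i) = k i := fun i => Nat.sub_sub_self (hk i)
  have hh : (fun i => ⟨d - k i, by omega⟩ : Fin (u.length + 1) → Fin (d + 1)) ∈
      monotoneLabelings d u := fun i => by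
    have h1 := component_tailIndex_le N i
    rw [hkN, hkN] at h1
    have h2 := h1 (Ideal.mem_span_singleton_self _)
    rw [Fin.mk_le_mk]
    -- If the exponent at the tail is `d`, the component is zero and its label 0 is trivially
    -- minimal.
    by_cases h3 : k (tailIndex u i) < d
    · have := TruncPoly.le_of_eps_pow_mem h3 h2
      omega
    · omega
  refine ⟨_, hh, ?_⟩
  ext m
  rw [mem_ofLabeling]
  simp only [hdk, ← hkN]
  constructor
  · intro hm
    rw [← sum_single_coord w I hI d m]
    exact Submodule.sum_mem _ fun i _ => hm i
  · exact (mem_canonicalSubmodules_iff N).1 hN m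

variable (w I hI d)

/-- Canonical submodules correspond to labelings that increase weakly along the arrows. -/
noncomputable def labelingEquiv : monotoneLabelings d u ≃ canonicalSubmodules w I hI d :=
  Equiv.ofBijective
    (fun h => ⟨ofLabeling w I hI d h.1 h.2, ofLabeling_mem_canonicalSubmodules h.1 h.2⟩)
    ⟨fun h h' H => Subtype.ext (le_antisymm
      (le_of_ofLabeling_eq (hh := h.2) (hh' := h'.2) (congrArg Subtype.val H))
      (le_of_ofLabeling_eq (hh := h'.2) (hh' := h.2) (congrArg Subtype.val H).symm)), fun N => by
        obtain ⟨h, hh, H⟩ := exists_ofLabeling_eq N.2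
        exact ⟨⟨h, hh⟩, Subtype.ext H⟩⟩

theorem finite_canonicalSubmodules : (canonicalSubmodules w I hI d).Finite :=
  Set.finite_coe_iff.1 (Finite.of_equiv _ (labelingEquiv w I hI d))

theorem ncard_canonicalSubmodules :
    (canonicalSubmodules w I hI d).ncard = transferCount d u := by
  rw [← ncard_monotoneLabelings, ← Nat.card_coe_set_eq, ← Nat.card_coe_set_eq]
  exact (Nat.card_congr (labelingEquiv w I hI d)).symm

/-- When the vertices are distinct, the idempotent of the vertex at `i`, tensored with 1, extracts
the `i`-th coordinate, and submodules are stable under it. -/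
theorem canonicalSubmodules_eq_univ (hw : Function.Injective w.vertex) :
    canonicalSubmodules w I hI d = Set.univ := by
  refine Set.eq_univ_of_forall fun N => (mem_canonicalSubmodules_iff N).2 fun m hm i => ?_
  have h1 := N.smul_mem ((Ideal.Quotient.mk I (RingQuot.mkAlgHom K (PathRel K V)
    (FreeAlgebra.ι K (Sum.inl (w.vertex i))))) ⊗ₜ[K] 1) hm
  rw [mem_component]
  convert h1 using 1
  conv_rhs => rw [← sum_single_coord w I hI d m, Finset.smul_sum]
  rw [Finset.sum_eq_single i]
  · rw [tmul_smul_single, vertex_smul w I hI hw, equivFun_basisVec, Pi.single_eq_same, one_smul,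
      one_mul, single_apply]
  · intro j _ hj
    rw [tmul_smul_single, vertex_smul w I hI hw, equivFun_basisVec, Pi.single_eq_of_ne hj.symm,
      zero_smul, ← mkHom_apply, map_zero, LinearMap.zero_apply]
  · simp

end InducedStringModule

/-! ### The main theorem -/

theorem mainTheorem5 {K : Type*} [Field K] {V : Type*} [Fintype V] [Quiver V]
    (s : List SnakeStep) (w : QuiverString V (abstractString s))
    (I : Ideal (PathAlgebra K V)) [I.IsTwoSided] (hI : w.IsAnnihilatedBy K I) (d : ℕ) :
    -- the number of `d`-dimer covers is the number of canonical submodules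
    ((dimerCovers (snakeGraph s) d).Finite ∧ (canonicalSubmodules w I hI d).Finite ∧
      (dimerCovers (snakeGraph s) d).ncard = (canonicalSubmodules w I hI d).ncard) ∧
    -- it is the number of all submodules if the string does not repeat a vertex
    (Function.Injective w.vertex →
      canonicalSubmodules w I hI d = Set.univ ∧ Finite (InducedStringSubmodule w I hI d) ∧
        (dimerCovers (snakeGraph s) d).ncard = Nat.card (InducedStringSubmodule w I hI d)) ∧
    -- matrix product and higher continued fraction
    ∀ a : List ℕ, IsSnakeGraphOfCF s a →
      (canonicalSubmodules w I hI d).ncard = (a.map (multichooseMatrix d)).prod 0 0 ∧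
      (canonicalSubmodules w I hI d).ncard = higherCFNum d a d ∧
      0 < higherCFDen d a ∧
      (∀ s' : List SnakeStep, IsSnakeGraphOfCF s' a.tail →
        higherCFDen d a = (dimerCovers (snakeGraph s') d).ncard) ∧
      ∀ i ≤ d, higherCF d a i = (higherCFNum d a i : ℚ) / (higherCFDen d a : ℚ) := by
  have hcount : (dimerCovers (snakeGraph s) d).ncard = (canonicalSubmodules w I hI d).ncard := by
    rw [ncard_dimerCovers_snakeGraph, InducedStringModule.ncard_canonicalSubmodules]
  have hfin := InducedStringModule.finite_canonicalSubmodules w I hI d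
  refine ⟨⟨finite_dimerCovers_snakeGraph s d, hfin, hcount⟩, fun hw => ?_, fun a ha => ?_⟩
  · have huniv := InducedStringModule.canonicalSubmodules_eq_univ w I hI d hw
    rw [huniv] at hfin hcount
    exact ⟨huniv, Set.finite_univ_iff.1 hfin, hcount.trans (Set.ncard_univ _)⟩
  · have hprod : (canonicalSubmodules w I hI d).ncard =
        (a.map (multichooseMatrix d)).prod 0 0 := by
      rw [InducedStringModule.ncard_canonicalSubmodules, transferCount_abstractString d ha]
    refine ⟨hprod, hprod.trans (higherCFNum_eq_prod d a ha.ne_nil).symm,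
      higherCFDen_pos d a ha.1, fun s' hs' => ?_, fun i _ => higherCF_eq_num_div_den d a ha.1 i⟩
    -- The tail is nonempty because it has a snake graph, so the default denominator 1 of short
    -- lists does not occur.
    have hden : ∀ a : List ℕ, a.tail ≠ [] → higherCFDen d a = higherCFNum d a.tail d
      | [], h => absurd rfl h
      | [_], h => absurd rfl h
      | _ :: _ :: _, _ => rfl
    rw [hden a hs'.ne_nil, higherCFNum_eq_prod d _ hs'.ne_nil, ncard_dimerCovers_snakeGraph,
      transferCount_abstractString d hs']
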